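/- **Problems.** In the *rank reduction problem on transversal matroids* one is given a bipartite graph $H$ with bipartition $(A,B)$ and a positive integer $k$. Let $M$ be the transversal matroid on $A$ with model $H$ (a set $I\subseteq A$ is independent iff $H$ has a matching covering $I$), with rank function $r$, and assume $k\le r(A)$. The goal is to find a set $X\subseteq A$ of minimum size such that $r(A\setminus X)\le r(A)-k$. In the *densest $k$-subgraph problem* one is given a finite simple graph $G$ on $n$ vertices and an integer $k$ with $1\le k\le n$, and the goal is to find a set $S$ of $k$ vertices of $G$ such that the number of edges of the induced subgraph $G[S]$ is maximum. **Algorithms.** A $\rho(m)$-approximation algorithm for the rank reduction problem on transversal matroids with $m=|A|$ elements is a deterministic polynomial-time algorithm that returns, on every such instance, a feasible set $X$ with $|X|\le\rho(m)\,|X'|$ for every feasible set $X'$. A $\rho(n)$-approximation algorithm for the densest $k$-subgraph problem is a deterministic polynomial-time algorithm that returns, on every such instance, a set $S$ of $k$ vertices such that $|E(G[S'])|\le\rho(n)\,|E(G[S])|$ for every set $S'$ of $k$ vertices. Graphs are given by their adjacency matrices (bipartite graphs by their $A\times B$ matrices), $k$ is written in unary, and running time is polynomial in the size of the input. **Theorem.**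 Let $0<\varepsilon<1/4$ be a constant. Every $O(m^{\varepsilon})$-approximation algorithm for the rank reduction problem on transversal matroids with $m$ elements can be turned into an $O(n^{4\varepsilon})$-approximation algorithm for the densest $k$-subgraph problem on graphs with $n$ vertices. That is, if for some constant $c$ there is a $c\,m^{\varepsilon}$-approximation algorithm for the former problem, then for some constant $C$ there is a $C\,n^{4\varepsilon}$-approximation algorithm for the latter. -/

import Mathlib

namespace RankReduction

/-! ### The model of computation

A program works on finitely many registers, each of which points to an immutable binary tree, as in a
minimal LISP machine.  Every command below takes constant time on pointers, so it is charged one unit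
of time.  Polynomial time in this model is polynomial time on Turing machines. -/

/-- The values held by the registers: finite binary trees (LISP data with the single atom `nil`). -/
inductive Data : Type
  | nil : Data
  | cons (l r : Data) : Data

namespace Data

/-- The left component of a pair; `nil` has left component `nil`. -/
def hd : Data → Data
  | nil => nil
  | cons l _ => l

/-- The right component of a pair; `nil` has right component `nil`. -/
def tl : Data → Data
  | nil => nil
  | cons _ r => r

/-- The size of a value: the number of nodes of the tree. -/
def size : Data → ℕ
  | nil => 1
  | cons l r => l.size + r.size + 1

/-- A list of values as a single value. -/
def ofList (L : List Data) : Data := L.foldr cons nil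

/-- A truth value as a value. -/
def ofBool : Bool → Data
  | false => nil
  | true => cons nil nil

/-- A natural number in unary as a value. -/
def ofNat (n : ℕ) : Data := ofList (List.replicate n nil)

open Classical in
/-- A subset of `Fin n`, given by its characteristic vector. -/
noncomputable def ofFinset {n : ℕ} (S : Finset (Fin n)) : Data :=
  ofList (List.ofFn fun i : Fin n => ofBool (decide (i ∈ S)))

open Classical in
/-- A relation between `Fin a` and `Fin b`, given by its 0/1 matrix with rows indexed by `Fin a`. -/
noncomputable def ofRel {a b : ℕ} (R : Fin a → Fin b → Prop) : Data :=
  ofList (List.ofFn fun i : Fin a => ofList (List.ofFn fun j : Fin b => ofBool (decide (R i j))))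

end Data

/-- Programs.  Registers are numbered by `ℕ`; a program mentions only finitely many of them. -/
inductive Cmd : Type
  | skip : Cmd
  | setNil (x : ℕ) : Cmd
  | copy (x y : ℕ) : Cmd
  | cons (x y z : ℕ) : Cmd
  | hd (x y : ℕ) : Cmd
  | tl (x y : ℕ) : Cmd
  | seq (P Q : Cmd) : Cmd
  | ite (x : ℕ) (P Q : Cmd) : Cmd
  | loop (x : ℕ) (P : Cmd) : Cmd

/-- `Runs P s t s'`: started with register contents `s`, the program `P` halts after exactly `t` steps
with register contents `s'`.  Every elementary command and every test counts as one step;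
`ite x P Q` runs `P` if register `x` is not `nil` and `Q` otherwise, and `loop x P` repeats `P` while
register `x` is not `nil`. -/
inductive Runs : Cmd → (ℕ → Data) → ℕ → (ℕ → Data) → Prop
  | skip (s : ℕ → Data) : Runs Cmd.skip s 1 s
  | setNil (s : ℕ → Data) (x : ℕ) : Runs (Cmd.setNil x) s 1 (Function.update s x Data.nil)
  | copy (s : ℕ → Data) (x y : ℕ) : Runs (Cmd.copy x y) s 1 (Function.update s x (s y))
  | cons (s : ℕ → Data) (x y z : ℕ) :
      Runs (Cmd.cons x y z) s 1 (Function.update s x (Data.cons (s y) (s z)))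
  | hd (s : ℕ → Data) (x y : ℕ) : Runs (Cmd.hd x y) s 1 (Function.update s x (s y).hd)
  | tl (s : ℕ → Data) (x y : ℕ) : Runs (Cmd.tl x y) s 1 (Function.update s x (s y).tl)
  | seq {P Q : Cmd} {s s' s'' : ℕ → Data} {t t' : ℕ} :
      Runs P s t s' → Runs Q s' t' s'' → Runs (Cmd.seq P Q) s (t + t') s''
  | iteThen {P Q : Cmd} {s s' : ℕ → Data} {t x : ℕ} :
      s x ≠ Data.nil → Runs P s t s' → Runs (Cmd.ite x P Q) s (t + 1) s'
  | iteElse {P Q : Cmd} {s s' : ℕ → Data} {t x : ℕ} :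
      s x = Data.nil → Runs Q s t s' → Runs (Cmd.ite x P Q) s (t + 1) s'
  | loopStop {P : Cmd} {s : ℕ → Data} {x : ℕ} : s x = Data.nil → Runs (Cmd.loop x P) s 1 s
  | loopStep {P : Cmd} {s s' s'' : ℕ → Data} {t t' x : ℕ} :
      s x ≠ Data.nil → Runs P s t s' → Runs (Cmd.loop x P) s' t' s'' →
        Runs (Cmd.loop x P) s (t + t' + 1) s''

/-- `ComputesWithin P d T e`: started with the input `d` in register `0` and `nil` in all others, the
program `P` halts after at most `T` steps, with the output `e` in register `0`. -/
def ComputesWithin (P : Cmd) (d : Data) (T : ℕ) (e : Data) : Prop :=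
  ∃ t ≤ T, ∃ s : ℕ → Data, Runs P (Function.update (fun _ => Data.nil) 0 d) t s ∧ s 0 = e

/-! ### Transversal matroids and the rank reduction problem -/

section Transversal

variable {α β : Type*}

/-- `Matchable H I`: the bipartite graph `H` with sides `α` and `β` has a matching that covers
`I ⊆ α`. -/
def Matchable (H : α → β → Prop) (I : Set α) : Prop :=
  ∃ f : I → β, Function.Injective f ∧ ∀ x : I, H x (f x)

theorem matchable_iff [Nonempty β] (H : α → β → Prop) (I : Set α) :
    Matchable H I ↔ ∃ f : α → β, Set.InjOn f I ∧ ∀ x ∈ I, H x (f x) := by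
  classical
  constructor
  · rintro ⟨f, hf, h⟩
    refine ⟨fun x => if hx : x ∈ I then f ⟨x, hx⟩ else Classical.arbitrary β, ?_, ?_⟩
    · intro x hx y hy hxy
      simp only [hx, hy, dif_pos] at hxy
      simpa using hf hxy
    · intro x hx
      simpa [hx] using h ⟨x, hx⟩
  · rintro ⟨f, hf, h⟩
    exact ⟨fun x => f x, fun x y hxy => Subtype.ext (hf x.2 y.2 hxy), fun x => h x x.2⟩

theorem Matchable.augment [Finite α] {H : α → β → Prop} {I J : Set α} (hI : Matchable H I)
    (hJ : Matchable H J) (hIJ : I.ncard < J.ncard) :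
    ∃ e ∈ J, e ∉ I ∧ Matchable H (insert e I) := by
  classical
  rcases isEmpty_or_nonempty β with hβ | hβ
  · obtain ⟨f, -, -⟩ := hJ
    have : IsEmpty J := ⟨fun x => hβ.elim (f x)⟩
    have hJ0 : J = ∅ := Set.isEmpty_coe_sort.1 this
    simp [hJ0] at hIJ
  by_contra hcon
  push Not at hcon
  obtain ⟨f, hf, hfH⟩ := (matchable_iff H J).1 hJ
  obtain ⟨g₀, hg₀, hg₀H⟩ := (matchable_iff H I).1 hI
  have key : ∀ n : ℕ, ∃ g : α → β, Set.InjOn g I ∧ (∀ x ∈ I, H x (g x)) ∧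
      n ≤ {x ∈ I | g x = f x}.ncard := by
    intro n
    induction n with
    | zero => exact ⟨g₀, hg₀, hg₀H, Nat.zero_le _⟩
    | succ n ih =>
      obtain ⟨g, hg, hgH, hn⟩ := ih
      have hlt : (g '' I).ncard < (f '' J).ncard := by
        rwa [hg.ncard_image, hf.ncard_image]
      obtain ⟨y, ⟨x, hxJ, rfl⟩, hy⟩ := Set.exists_mem_notMem_of_ncard_lt_ncard hlt
      have hne : ∀ z ∈ I, g z ≠ f x := fun z hz h => hy ⟨z, hz, h⟩
      have hinj : Set.InjOn (Function.update g x (f x)) (insert x I) := by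
        intro u hu v hv huv
        by_cases hux : u = x <;> by_cases hvx : v = x
        · rw [hux, hvx]
        · subst hux
          rw [Function.update_self, Function.update_of_ne hvx] at huv
          exact absurd huv.symm (hne v (Set.mem_of_mem_insert_of_ne hv hvx))
        · subst hvx
          rw [Function.update_self, Function.update_of_ne hux] at huv
          exact absurd huv (hne u (Set.mem_of_mem_insert_of_ne hu hux))
        · rw [Function.update_of_ne hux, Function.update_of_ne hvx] at huv
          exact hg (Set.mem_of_mem_insert_of_ne hu hux) (Set.mem_of_mem_insert_of_ne hv hvx) huv
      have hH : ∀ u ∈ insert x I, H u (Function.update g x (f x) u) := by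
        intro u hu
        by_cases hux : u = x
        · subst hux
          rw [Function.update_self]
          exact hfH u hxJ
        · rw [Function.update_of_ne hux]
          exact hgH u (Set.mem_of_mem_insert_of_ne hu hux)
      have hxI : x ∈ I := by
        by_contra hxI
        exact hcon x hxJ hxI ((matchable_iff H _).2 ⟨_, hinj, hH⟩)
      refine ⟨Function.update g x (f x), hinj.mono (Set.subset_insert _ _),
        fun u hu => hH u (Set.mem_insert_of_mem _ hu), ?_⟩
      refine Nat.succ_le_of_lt (lt_of_le_of_lt hn (Set.ncard_lt_ncard ?_ (Set.toFinite _)))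
      refine (Set.ssubset_iff_of_subset ?_).2 ⟨x, ⟨hxI, by simp⟩, fun h => hne x hxI h.2⟩
      rintro u ⟨huI, hu⟩
      have hux : u ≠ x := by
        rintro rfl
        exact hne u huI hu
      exact ⟨huI, by rw [Function.update_of_ne hux, hu]⟩
  obtain ⟨g, -, -, hn⟩ := key (Nat.card α + 1)
  have := Set.ncard_le_card {x ∈ I | g x = f x}
  omega

/-- The transversal matroid on `α` with model the bipartite graph `H`: a set `I ⊆ α` is independent
iff `H` has a matching covering `I`. -/
def transversalMatroid [Finite α] (H : α → β → Prop) : Matroid α :=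
  (IndepMatroid.ofFinite (E := Set.univ) Set.finite_univ (Matchable H)
    ⟨fun x => x.2.elim, fun x => x.2.elim, fun x => x.2.elim⟩
    (fun _ _ ⟨f, hf, h⟩ hIJ => ⟨fun x => f ⟨x, hIJ x.2⟩,
      fun _ _ hxy => Subtype.ext (Subtype.mk.inj (hf hxy)), fun x => h ⟨x, hIJ x.2⟩⟩)
    (fun _ _ hI hJ hIJ => hI.augment hJ hIJ)
    (fun _ _ => Set.subset_univ _)).matroid

theorem transversalMatroid_indep [Finite α] (H : α → β → Prop) (I : Set α) :
    (transversalMatroid H).Indep I ↔ Matchable H I := Iff.rfl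

theorem transversalMatroid_ground [Finite α] (H : α → β → Prop) :
    (transversalMatroid H).E = Set.univ := rfl

/-- Removing `X` from the matroid `M` reduces its rank by at least `k`, that is,
`r(E \ X) ≤ r(E) - k`. -/
def ReducesRank (M : Matroid α) (k : ℕ) (X : Set α) : Prop :=
  X ⊆ M.E ∧ M.eRk (M.E \ X) + k ≤ M.eRk M.E

end Transversal

/-- `P` is a polynomial-time algorithm for the rank reduction problem on transversal matroids with
approximation ratio `ρ m`, where `m` is the number of elements.  The input consists of a model of the
matroid (a bipartite graph `H` with sides `Fin m` and `Fin b`) and the integer `k`; the instances are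
those that have a feasible solution, that is, those with `k` at most the rank. -/
def IsRankReductionApprox (P : Cmd) (ρ : ℕ → ℝ) : Prop :=
  ∃ p : Polynomial ℕ, ∀ (m b k : ℕ) (H : Fin m → Fin b → Prop),
    1 ≤ k → (k : ℕ∞) ≤ (transversalMatroid H).eRank →
    ∃ X : Finset (Fin m),
      ComputesWithin P (Data.cons (Data.ofRel H) (Data.ofNat k))
        (p.eval (Data.cons (Data.ofRel H) (Data.ofNat k)).size) (Data.ofFinset X) ∧
      ReducesRank (transversalMatroid H) k X ∧
      ∀ X' : Finset (Fin m), ReducesRank (transversalMatroid H) k X' →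
        (X.card : ℝ) ≤ ρ m * (X'.card : ℝ)

/-- The number of edges of the subgraph of `G` induced by `S`. -/
noncomputable def inducedEdges {n : ℕ} (G : SimpleGraph (Fin n)) (S : Finset (Fin n)) : ℕ :=
  (G.induce (S : Set (Fin n))).edgeSet.ncard

/-- `Q` is a polynomial-time algorithm for the densest `k`-subgraph problem (find `k` vertices inducing
a maximum number of edges) with approximation ratio `ρ n`, where `n` is the number of vertices.  The
input consists of the graph, given by its adjacency matrix, and the integer `k`. -/
def IsDensestSubgraphApprox (Q : Cmd) (ρ : ℕ → ℝ) : Prop :=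
  ∃ q : Polynomial ℕ, ∀ (n k : ℕ) (G : SimpleGraph (Fin n)), 1 ≤ k → k ≤ n →
    ∃ S : Finset (Fin n),
      ComputesWithin Q (Data.cons (Data.ofRel G.Adj) (Data.ofNat k))
        (q.eval (Data.cons (Data.ofRel G.Adj) (Data.ofNat k)).size) (Data.ofFinset S) ∧
      S.card = k ∧
      ∀ S' : Finset (Fin n), S'.card = k →
        (inducedEdges G S' : ℝ) ≤ ρ n * (inducedEdges G S : ℝ)

end RankReduction

namespace RankReduction

/-! ### Programs that change register `0` only -/

/-! Take a graph on `n` vertices. The reduction gives each vertex `4 * n` copies as matroid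
elements, and each copy is joined to all ordered adjacent pairs containing its vertex. So `m = 4 * n
^ 2`, and the rank is twice the number of edges. Deleting all copies of a set `S` isolates exactly
the pairs inside `S`, so the rank drops by at least their number (`reducesRank_copiesOf`).

Conversely, suppose deleting `X` lowers the rank by `l`, and let `W` be the set of vertices with
more than `2 * n` copies in `X`. A pair not inside `W` has an endpoint outside `W`, which keeps at
least `2 * n` copies. A vertex lies in at most `2 * n` ordered pairs, so all pairs not inside `W`
can be matched simultaneously. Hence `W` contains at least `l` ordered pairs
(`le_card_orderedEdges_majority`), while `|W| ≤ |X| / (2 * n)` (`card_majority_le`).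

Let an optimal `k`-set have `e` edges. For `l = 2 * e` its copies form a feasible set of size `4 * n
* k`, so a `ρ`-approximation yields `|W| ≤ 2 * ρ * k` with at least `e` edges in `W`. If `W` is too
small, any insertions will do. If it is too large, deleting the best vertex one at a time never
lowers the density `E / (w * (w - 1))` (`exists_erase_card_orderedEdges`, `iterate_of_le_card`), so
the loss is at most `8 * ρ ^ 2`. With `ρ = c * m ^ ε` this is a constant times `n ^ (4 * ε)`. Since
`e` is unknown, all feasible `l` are tried and the best result is kept
(`inducedEdges_le_of_approx`).

That this is a polynomial-time algorithm is shown in the given machine model. Programs that alter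
only register `0` compose freely, which yields closure properties of `PolyTime` (composition,
pairing, branching, folding). The algorithm is written as a function on Boolean lists built from
these. -/

/-- A strict upper bound on the registers that a program mentions. -/
def Cmd.bound : Cmd → ℕ
  | .skip => 0
  | .setNil x => x + 1
  | .copy x y => max (x + 1) (y + 1)
  | .cons x y z => max (x + 1) (max (y + 1) (z + 1))
  | .hd x y => max (x + 1) (y + 1)
  | .tl x y => max (x + 1) (y + 1)
  | .seq P Q => max P.bound Q.bound
  | .ite x P Q => max (x + 1) (max P.bound Q.bound)
  | .loop x P => max (x + 1) P.bound

/-- The register contents that agree with `s` below `K` and with `r` from `K` on. -/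
def overlay (K : ℕ) (s r : ℕ → Data) : ℕ → Data := fun i => if i < K then s i else r i

theorem overlay_of_lt {K i : ℕ} (h : i < K) (s r : ℕ → Data) : overlay K s r i = s i := if_pos h

theorem overlay_update {K x : ℕ} (h : x < K) (s r : ℕ → Data) (d : Data) :
    overlay K (Function.update s x d) r = Function.update (overlay K s r) x d := by
  funext i
  by_cases hi : i = x
  · subst hi; simp [overlay, h]
  · simp [overlay, Function.update_of_ne hi]

/-- A run does not depend on the registers that the program does not mention. -/
theorem Runs.frame {P : Cmd} {s s' : ℕ → Data} {t : ℕ} (h : Runs P s t s') {K : ℕ}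
    (hK : P.bound ≤ K) (r : ℕ → Data) : Runs P (overlay K s r) t (overlay K s' r) := by
  induction h with
  | skip s => exact .skip _
  | setNil s x => rw [overlay_update (by simpa [Cmd.bound] using hK)]; exact .setNil _ _
  | copy s x y =>
    simp only [Cmd.bound, max_le_iff, Nat.succ_le_iff] at hK
    rw [overlay_update hK.1, ← overlay_of_lt hK.2 s r]; exact .copy _ _ _
  | cons s x y z =>
    simp only [Cmd.bound, max_le_iff, Nat.succ_le_iff] at hK
    rw [overlay_update hK.1, ← overlay_of_lt hK.2.1 s r, ← overlay_of_lt hK.2.2 s r]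
    exact .cons _ _ _ _
  | hd s x y =>
    simp only [Cmd.bound, max_le_iff, Nat.succ_le_iff] at hK
    rw [overlay_update hK.1, ← overlay_of_lt hK.2 s r]; exact .hd _ _ _
  | tl s x y =>
    simp only [Cmd.bound, max_le_iff, Nat.succ_le_iff] at hK
    rw [overlay_update hK.1, ← overlay_of_lt hK.2 s r]; exact .tl _ _ _
  | seq _ _ ih₁ ih₂ =>
    simp only [Cmd.bound, max_le_iff] at hK
    exact .seq (ih₁ hK.1) (ih₂ hK.2)
  | iteThen hx _ ih =>
    simp only [Cmd.bound, max_le_iff, Nat.succ_le_iff] at hK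
    exact .iteThen (by rwa [overlay_of_lt hK.1]) (ih hK.2.1)
  | iteElse hx _ ih =>
    simp only [Cmd.bound, max_le_iff, Nat.succ_le_iff] at hK
    exact .iteElse (by rwa [overlay_of_lt hK.1]) (ih hK.2.2)
  | loopStop hx =>
    simp only [Cmd.bound, max_le_iff, Nat.succ_le_iff] at hK
    exact .loopStop (by rwa [overlay_of_lt hK.1])
  | loopStep hx _ _ ih₁ ih₂ =>
    have hK' := hK
    simp only [Cmd.bound, max_le_iff, Nat.succ_le_iff] at hK
    exact .loopStep (by rwa [overlay_of_lt hK.1]) (ih₁ hK.2) (ih₂ hK')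

/-- The program that clears the registers `1, …, n`. -/
def clear : ℕ → Cmd
  | 0 => .skip
  | n + 1 => .seq (clear n) (.setNil (n + 1))

theorem runs_clear (n : ℕ) (s : ℕ → Data) :
    Runs (clear n) s (n + 1) (fun i => if 1 ≤ i ∧ i ≤ n then Data.nil else s i) := by
  induction n with
  | zero =>
    have : (fun i => if 1 ≤ i ∧ i ≤ 0 then Data.nil else s i) = s := by
      funext i
      rw [if_neg (by omega)]
    rw [this]
    exact Runs.skip s
  | succ n ih =>
    refine Eq.subst (motive := Runs _ s _) ?_ (Runs.seq ih (Runs.setNil _ (n + 1)))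
    funext i
    by_cases hi : i = n + 1
    · subst hi; simp
    · rw [Function.update_of_ne hi]
      simp only [show (1 ≤ i ∧ i ≤ n + 1) ↔ (1 ≤ i ∧ i ≤ n) by omega]

/-- Started with `d` in register `0` and `nil` in the other registers below `K`, the program `P` halts
after at most `T` steps; it has then replaced `d` by `e` and changed nothing else. -/
def Implements (P : Cmd) (K T : ℕ) (d e : Data) : Prop :=
  ∃ t ≤ T, ∀ s : ℕ → Data, s 0 = d → (∀ i, 1 ≤ i → i < K → s i = Data.nil) →
    Runs P s t (Function.update s 0 e)

theorem Implements.computesWithin {P : Cmd} {K T : ℕ} {d e : Data} (h : Implements P K T d e) :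
    ComputesWithin P d T e := by
  obtain ⟨t, ht, h⟩ := h
  refine ⟨t, ht, _, h _ (by simp) fun i hi _ => ?_, by simp⟩
  rw [Function.update_of_ne (by omega)]

/-- By the frame property the run is unaffected by contents beyond the registers of `P`, and
clearing the scratch registers restores their initial `nil`. The bound is raised by one so that
register `0` belongs to the framed part even if `P` mentions no register. -/
theorem ComputesWithin.implements {P : Cmd} {T : ℕ} {d e : Data} (h : ComputesWithin P d T e) :
    Implements (.seq P (clear P.bound)) (P.bound + 1) (T + (P.bound + 1)) d e := by
  obtain ⟨t, ht, s', h, rfl⟩ := h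
  refine ⟨t + (P.bound + 1), by omega, fun s hs hnil => ?_⟩
  have h₁ := h.frame (Nat.le_succ P.bound) s
  have h₂ : overlay (P.bound + 1) (Function.update (fun _ => Data.nil) 0 d) s = s := by
    funext i
    by_cases hi : i = 0
    · subst hi; simp [overlay, hs]
    · by_cases hK : i < P.bound + 1
      · simp [overlay, hK, Function.update_of_ne hi, hnil i (by omega) hK]
      · simp [overlay, hK]
  rw [h₂] at h₁
  convert Runs.seq h₁ (runs_clear P.bound _) using 1
  funext i
  by_cases hi : i = 0
  · subst hi; simp [overlay]
  · rw [Function.update_of_ne hi]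
    by_cases hK : i < P.bound + 1
    · rw [if_pos ⟨by omega, by omega⟩, hnil i (by omega) hK]
    · rw [if_neg (by omega)]; simp [overlay, hK]

/-! ### Combinators: sequence, pairing, branching, folding -/

theorem Implements.mono {P : Cmd} {K K' T T' : ℕ} {d e : Data} (h : Implements P K T d e)
    (hK : K ≤ K') (hT : T ≤ T') : Implements P K' T' d e := by
  obtain ⟨t, ht, h⟩ := h
  exact ⟨t, ht.trans hT, fun s hs hnil => h s hs fun i h1 h2 => hnil i h1 (h2.trans_le hK)⟩

theorem Implements.seq {P Q : Cmd} {K T T' : ℕ} {d e f : Data} (h : Implements P K T d e)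
    (h' : Implements Q K T' e f) : Implements (.seq P Q) K (T + T') d f := by
  obtain ⟨t, ht, h⟩ := h
  obtain ⟨t', ht', h'⟩ := h'
  refine ⟨t + t', by omega, fun s hs hnil => .seq (h s hs hnil) ?_⟩
  have := h' (Function.update s 0 e) (by simp) fun i h1 h2 => by
    rw [Function.update_of_ne (by omega), hnil i h1 h2]
  rwa [Function.update_idem] at this

/-- The program that replaces the contents of register `0` by the pair of the results of `P` and `Q`;
it uses the registers `K` and `K + 1` to save intermediate results. -/
def pairCmd (P Q : Cmd) (K : ℕ) : Cmd :=
  .seq (.copy K 0) (.seq P (.seq (.copy (K + 1) 0) (.seq (.copy 0 K) (.seq Q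
    (.seq (.cons 0 (K + 1) 0) (.seq (.setNil K) (.setNil (K + 1))))))))

/-- `Implements` requires `nil` only below `K` and leaves everything but register `0` intact, so
values saved in registers `K` and `K + 1` survive the runs of `P` and `Q`. -/
theorem Implements.pair {P Q : Cmd} {K T T' : ℕ} {d e f : Data} (hK : 1 ≤ K)
    (h : Implements P K T d e) (h' : Implements Q K T' d f) :
    Implements (pairCmd P Q K) (K + 2) (T + T' + 6) d (.cons e f) := by
  obtain ⟨t, ht, h⟩ := h
  obtain ⟨t', ht', h'⟩ := h'
  refine ⟨1 + (t + (1 + (1 + (t' + (1 + (1 + 1)))))), by omega, fun s hs hnil => ?_⟩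
  have h0K : (0 : ℕ) ≠ K := by omega
  have hK1 : (K + 1 : ℕ) ≠ K := by omega
  have r1 := Runs.copy s K 0
  have r2 := h (Function.update s K (s 0)) (by rw [Function.update_of_ne h0K, hs])
    fun i h1 h2 => by rw [Function.update_of_ne h2.ne, hnil i h1 (by omega)]
  have r3 := Runs.copy (Function.update (Function.update s K (s 0)) 0 e) (K + 1) 0
  set s3 := Function.update (Function.update (Function.update s K (s 0)) 0 e) (K + 1)
    (Function.update (Function.update s K (s 0)) 0 e 0) with hs3
  have r4 := Runs.copy s3 0 K
  have r5 := h' (Function.update s3 0 (s3 K)) (by simp [hs3, h0K.symm, hs])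
    fun i h1 h2 => by
      simp [hs3, show i ≠ 0 by omega, show i ≠ K by omega, show i ≠ K + 1 by omega,
        hnil i h1 (by omega)]
  refine .seq r1 (.seq r2 (.seq r3 (.seq r4 (.seq r5 ?_))))
  convert Runs.seq (Runs.cons _ 0 (K + 1) 0) (Runs.seq (Runs.setNil _ K) (Runs.setNil _ (K + 1)))
    using 1
  funext i
  by_cases h0 : i = 0
  · subst h0; simp [hs3, h0K]
  by_cases h1 : i = K + 1
  · subst h1; simp [hnil (K + 1) (by omega) (by omega)]
  by_cases h2 : i = K
  · subst h2; simp [h0, hnil i (by omega) (by omega)]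
  · simp [hs3, h0, h1, h2]

/-- The program that replaces the contents of register `0` by the result of `Q` if `P` computes a value
different from `nil`, and by the result of `R` otherwise. -/
def iteCmd (P Q R : Cmd) (K : ℕ) : Cmd :=
  .seq (.copy K 0) (.seq P (.seq (.copy (K + 1) 0) (.seq (.copy 0 K) (.seq (.setNil K)
    (.ite (K + 1) (.seq (.setNil (K + 1)) Q) R)))))

theorem Implements.ite {P Q R : Cmd} {K T T' : ℕ} {d e f : Data} (hK : 1 ≤ K)
    (h : Implements P K T d e) (hQ : e ≠ .nil → Implements Q K T' d f)
    (hR : e = .nil → Implements R K T' d f) :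
    Implements (iteCmd P Q R K) (K + 2) (T + T' + 6) d f := by
  obtain ⟨t, ht, h⟩ := h
  have h0K : (0 : ℕ) ≠ K := by omega
  have hK1 : (K + 1 : ℕ) ≠ K := by omega
  have main : ∀ s : ℕ → Data, s 0 = d → (∀ i, 1 ≤ i → i < K + 2 → s i = Data.nil) →
      Runs (.seq (.copy K 0) (.seq P (.seq (.copy (K + 1) 0) (.seq (.copy 0 K) (.setNil K)))))
        s (1 + (t + (1 + (1 + 1)))) (Function.update s (K + 1) e) := by
    intro s hs hnil
    have r2 := h (Function.update s K (s 0)) (by rw [Function.update_of_ne h0K, hs])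
      fun i h1 h2 => by rw [Function.update_of_ne h2.ne, hnil i h1 (by omega)]
    convert Runs.seq (Runs.copy s K 0) (.seq r2 (.seq (Runs.copy _ (K + 1) 0)
      (.seq (Runs.copy _ 0 K) (Runs.setNil _ K)))) using 1
    funext i
    by_cases h0 : i = 0
    · subst h0; simp [h0K, h0K.symm]
    by_cases h1 : i = K + 1
    · subst h1; simp
    by_cases h2 : i = K
    · subst h2; simp [hnil i (by omega) (by omega)]
    · simp [h0, h1, h2]
  -- The program is nested to the right, so the common prefix has to be taken apart before a branch
  -- can be appended to it.
  have assoc : ∀ {s s' : ℕ → Data} {t' : ℕ} {A B C D E F : Cmd} {u : ℕ},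
      Runs (.seq A (.seq B (.seq C (.seq D E)))) s u s' → ∀ {s''}, Runs F s' t' s'' →
      Runs (.seq A (.seq B (.seq C (.seq D (.seq E F))))) s (u + t') s'' := by
    intro s s' t' A B C D E F u h1 s'' h2
    cases h1 with
    | seq a b =>
    cases b with
    | seq b c =>
    cases c with
    | seq c d =>
    cases d with
    | seq d e =>
    simp only [add_assoc]
    exact .seq a (.seq b (.seq c (.seq d (.seq e h2))))
  by_cases he : e = .nil
  · obtain ⟨t', ht', hR⟩ := hR he
    refine ⟨1 + (t + (1 + (1 + 1))) + (t' + 1), by omega, fun s hs hnil => ?_⟩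
    refine assoc (main s hs hnil) ?_
    have hu : Function.update s (K + 1) e = s := by
      rw [he, ← hnil (K + 1) (by omega) (by omega), Function.update_eq_self]
    rw [hu]
    exact .iteElse (hnil (K + 1) (by omega) (by omega))
      (hR s hs fun i h1 h2 => hnil i h1 (by omega))
  · obtain ⟨t', ht', hQ⟩ := hQ he
    refine ⟨1 + (t + (1 + (1 + 1))) + ((1 + t') + 1), by omega, fun s hs hnil => ?_⟩
    refine assoc (main s hs hnil) (.iteThen (by simpa using he) (.seq (.setNil _ _) ?_))
    rw [Function.update_idem, ← hnil (K + 1) (by omega) (by omega), Function.update_eq_self]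
    exact hQ s hs fun i h1 h2 => hnil i h1 (by omega)

/-- The program that folds the list in the second component of register `0`, starting with the
accumulator in the third component, by means of the program `P`, which is also given the first
component. -/
def foldCmd (P : Cmd) (K : ℕ) : Cmd :=
  .seq (.hd K 0) (.seq (.tl 0 0) (.seq (.hd (K + 1) 0) (.seq (.tl (K + 2) 0) (.seq (.setNil 0)
    (.seq
      (.loop (K + 1)
        (.seq (.hd 0 (K + 1)) (.seq (.cons 0 0 (K + 2)) (.seq (.cons 0 K 0) (.seq P
          (.seq (.copy (K + 2) 0) (.seq (.setNil 0) (.tl (K + 1) (K + 1)))))))))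
      (.seq (.copy 0 (K + 2)) (.seq (.setNil K) (.setNil (K + 2)))))))))

/-- The step program is required to work only on accumulators that occur at prefixes of `L`. This
lets one time bound `T` cover all steps once the intermediate results are known to be small. -/
theorem Implements.fold {P : Cmd} {K T : ℕ} (hK : 1 ≤ K) {β σ : Type} (c : β → Data) (c' : σ → Data)
    (F : σ → β → σ) (a : Data) (L : List β) (acc : σ)
    (h : ∀ L' b, L' ++ [b] <+: L →
      Implements P K T (.cons a (.cons (c b) (c' (L'.foldl F acc)))) (c' (F (L'.foldl F acc) b))) :
    Implements (foldCmd P K) (K + 3) (L.length * (T + 7) + 9)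
      (.cons a (.cons (Data.ofList (L.map c)) (c' acc))) (c' (L.foldl F acc)) := by
  have h0K : (0 : ℕ) ≠ K := by omega
  -- Loop invariant: register `K` holds the parameter, `K + 1` the rest of the list, `K + 2` the
  -- accumulator, and register `0` is `nil`. The 7 is six elementary commands plus the loop test.
  have loop : ∀ (L : List β) (acc : σ), (∀ L' b, L' ++ [b] <+: L →
      Implements P K T (.cons a (.cons (c b) (c' (L'.foldl F acc)))) (c' (F (L'.foldl F acc) b))) →
      ∃ t ≤ L.length * (T + 7) + 1, ∀ s : ℕ → Data, s 0 = .nil → s K = a →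
        s (K + 1) = Data.ofList (L.map c) → s (K + 2) = c' acc → (∀ i, 1 ≤ i → i < K → s i = .nil) →
        Runs (.loop (K + 1)
          (.seq (.hd 0 (K + 1)) (.seq (.cons 0 0 (K + 2)) (.seq (.cons 0 K 0) (.seq P
          (.seq (.copy (K + 2) 0) (.seq (.setNil 0) (.tl (K + 1) (K + 1))))))))) s t
          (Function.update (Function.update s (K + 1) .nil) (K + 2) (c' (L.foldl F acc))) := by
    intro L
    induction L with
    | nil =>
      intro acc _
      refine ⟨1, by simp, fun s h0 ha hL hacc hnil => ?_⟩
      have : Function.update (Function.update s (K + 1) .nil) (K + 2) (c' (([] : List β).foldl F acc))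
          = s := by
        have hL' : s (K + 1) = .nil := hL
        rw [← hL', Function.update_eq_self, List.foldl_nil, ← hacc, Function.update_eq_self]
      rw [this]
      exact .loopStop hL
    | cons b L ih =>
      intro acc h
      obtain ⟨t, ht, hP⟩ := h [] b (by simp)
      obtain ⟨t', ht', ih⟩ := ih (F acc b) fun L' b' hL' => by
        simpa using h (b :: L') b' (by simpa using hL')
      refine ⟨1 + (1 + (1 + (t + (1 + (1 + 1))))) + t' + 1, ?_, fun s h0 ha hL hacc hnil => ?_⟩
      · rw [List.length_cons, add_mul]; omega
      have hL' : s (K + 1) = .cons (c b) (Data.ofList (L.map c)) := hL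
      have r1 := Runs.hd s 0 (K + 1)
      rw [hL'] at r1
      have r2 := Runs.cons (Function.update s 0 (c b)) 0 0 (K + 2)
      have r3 := Runs.cons (Function.update s 0 (Data.cons (c b) (c' acc))) 0 K 0
      have r4 := hP (Function.update s 0 (.cons a (.cons (c b) (c' acc)))) (by simp)
        fun i h1 h2 => by rw [Function.update_of_ne (by omega), hnil i h1 h2]
      rw [Function.update_idem] at r4
      have e2 : Function.update (Function.update s 0 (c b)) 0
          (.cons (Function.update s 0 (c b) 0) (Function.update s 0 (c b) (K + 2)))
          = Function.update s 0 (.cons (c b) (c' acc)) := by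
        simp [hacc]
      have e3 : Function.update (Function.update s 0 (Data.cons (c b) (c' acc))) 0
          (.cons (Function.update s 0 (Data.cons (c b) (c' acc)) K)
            (Function.update s 0 (Data.cons (c b) (c' acc)) 0))
          = Function.update s 0 (.cons a (.cons (c b) (c' acc))) := by
        simp [h0K.symm, ha]
      rw [e2] at r2
      rw [e3] at r3
      set s' := Function.update (Function.update s (K + 2) (c' (F acc b))) (K + 1) (Data.ofList (L.map c))
        with hs'
      have r5 : Runs (.seq (.copy (K + 2) 0) (.seq (.setNil 0) (.tl (K + 1) (K + 1))))
          (Function.update s 0 (c' (F acc b))) (1 + (1 + 1)) s' := by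
        convert Runs.seq (Runs.copy _ (K + 2) 0) (Runs.seq (Runs.setNil _ 0)
          (Runs.tl _ (K + 1) (K + 1))) using 1
        funext i
        by_cases i1 : i = K + 1
        · subst i1; simp [hs', hL', Data.tl]
        by_cases i0 : i = 0
        · subst i0; simp [hs', h0]
        by_cases i2 : i = K + 2
        · subst i2; simp [hs']
        · simp [hs', i0, i1, i2]
      have r6 := ih s' (by simp [hs', h0]) (by simp [hs', ha]) (by simp [hs']) (by simp [hs'])
        fun i h1 h2 => by
          simp [hs', show i ≠ K + 1 by omega, show i ≠ K + 2 by omega, hnil i h1 h2]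
      convert Runs.loopStep (by rw [hL']; simp) (.seq r1 (.seq r2 (.seq r3 (.seq r4 r5)))) r6 using 1
      funext i
      by_cases i1 : i = K + 1
      · subst i1; simp
      by_cases i2 : i = K + 2
      · subst i2; simp
      · simp [hs', i1, i2]
  obtain ⟨t, ht, hl⟩ := loop L acc h
  refine ⟨1 + (1 + (1 + (1 + (1 + (t + (1 + (1 + 1))))))), by omega, fun s hs hnil => ?_⟩
  set s₁ := Function.update (Function.update (Function.update (Function.update s K a) (K + 1)
    (Data.ofList (L.map c))) (K + 2) (c' acc)) 0 .nil with hs₁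
  have r := hl s₁ (by simp [hs₁]) (by simp [hs₁, h0K.symm]) (by simp [hs₁]) (by simp [hs₁])
    fun i h1 h2 => by
      simp [hs₁, show i ≠ 0 by omega, show i ≠ K by omega, show i ≠ K + 1 by omega,
        show i ≠ K + 2 by omega, hnil i h1 (by omega)]
  refine .seq (.hd _ K 0) (.seq (.tl _ 0 0) (.seq (.hd _ (K + 1) 0) (.seq (.tl _ (K + 2) 0) (.seq (.setNil _ 0) ?_))))
  have e : Function.update (Function.update (Function.update (Function.update (Function.update s K
      (s 0).hd) 0 (Function.update s K (s 0).hd 0).tl) (K + 1)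
      (Function.update (Function.update s K (s 0).hd) 0 (Function.update s K (s 0).hd 0).tl 0).hd)
      (K + 2) (Function.update (Function.update (Function.update s K (s 0).hd) 0
      (Function.update s K (s 0).hd 0).tl) (K + 1) (Function.update (Function.update s K (s 0).hd) 0
      (Function.update s K (s 0).hd 0).tl 0).hd 0).tl) 0 .nil = s₁ := by
    funext i
    by_cases i0 : i = 0
    · subst i0; simp [hs₁]
    by_cases i1 : i = K + 1
    · subst i1; simp [hs₁, h0K, hs, Data.hd, Data.tl]
    by_cases i2 : i = K + 2
    · subst i2; simp [hs₁, h0K, hs, Data.tl]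
    by_cases i3 : i = K
    · subst i3; simp [hs₁, i0, hs, Data.hd]
    · simp [hs₁, i0, i1, i2, i3]
  rw [e]
  refine .seq r ?_
  convert Runs.seq (Runs.copy _ 0 (K + 2)) (Runs.seq (Runs.setNil _ K) (Runs.setNil _ (K + 2)))
    using 1
  funext i
  by_cases i0 : i = 0
  · subst i0; simp [h0K]
  by_cases i1 : i = K + 1
  · subst i1; simp [hnil (K + 1) (by omega) (by omega)]
  by_cases i2 : i = K + 2
  · subst i2; simp [hnil (K + 2) (by omega) (by omega)]
  by_cases i3 : i = K
  · subst i3; simp [hnil i (by omega) (by omega), i0]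
  · simp [hs₁, i0, i1, i2, i3]

/-! ### Polynomial-time functions between types of coded objects -/

/-- A coding of the elements of a type as values of registers. -/
class Coded (α : Type) where
  /-- The value that represents an element. -/
  code : α → Data

open Coded (code)

instance : Coded Unit := ⟨fun _ => .nil⟩
instance : Coded Bool := ⟨Data.ofBool⟩
instance : Coded ℕ := ⟨Data.ofNat⟩
instance {α β : Type} [Coded α] [Coded β] : Coded (α × β) := ⟨fun x => .cons (code x.1) (code x.2)⟩
instance {α : Type} [Coded α] : Coded (List α) := ⟨fun l => Data.ofList (l.map code)⟩

section

variable {α β γ σ : Type} [Coded α] [Coded β] [Coded γ] [Coded σ]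

/-- The size of the code of an object. -/
def codeSize (a : α) : ℕ := (code a).size

theorem code_pair (a : α) (b : β) : code (a, b) = .cons (code a) (code b) := rfl
theorem code_nil : code ([] : List α) = .nil := rfl
theorem code_succ (n : ℕ) : code (n + 1) = .cons .nil (code n) := rfl
theorem code_false : code false = .nil := rfl
theorem code_true : code true = .cons .nil .nil := rfl

theorem codeSize_pos (a : α) : 0 < codeSize a := by
  unfold codeSize; cases code a <;> simp [Data.size]

theorem codeSize_pair (a : α) (b : β) : codeSize (a, b) = codeSize a + codeSize b + 1 := rfl
theorem codeSize_nil : codeSize ([] : List α) = 1 := rfl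
theorem codeSize_cons (a : α) (l : List α) :
    codeSize (a :: l) = codeSize a + codeSize l + 1 := rfl
theorem codeSize_bool_le (b : Bool) : codeSize b ≤ 3 := by
  cases b <;> simp [codeSize, code_false, code_true, Data.size]

theorem codeSize_nat (n : ℕ) : codeSize n = 2 * n + 1 := by
  induction n with
  | zero => rfl
  | succ n ih => simp only [codeSize, code_succ, Data.size] at ih ⊢; omega

theorem codeSize_append (l l' : List α) : codeSize (l ++ l') + 1 = codeSize l + codeSize l' := by
  induction l with
  | nil => rw [List.nil_append, codeSize_nil]; omega
  | cons a l ih => rw [List.cons_append, codeSize_cons, codeSize_cons]; omega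

theorem codeSize_reverse (l : List α) : codeSize l.reverse = codeSize l := by
  induction l with
  | nil => rfl
  | cons a l ih =>
    have := codeSize_append l.reverse [a]
    rw [codeSize_cons, codeSize_nil] at this
    rw [List.reverse_cons, codeSize_cons]; omega

theorem codeSize_prefix_le {l l' : List α} (h : l <+: l') : codeSize l ≤ codeSize l' := by
  obtain ⟨t, rfl⟩ := h
  have := codeSize_append l t
  have := codeSize_pos t
  omega

theorem codeSize_le_of_mem {a : α} {l : List α} (h : a ∈ l) : codeSize a ≤ codeSize l := by
  induction l with
  | nil => simp at h
  | cons b l ih =>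
    rw [codeSize_cons]
    rcases List.mem_cons.1 h with rfl | h
    · omega
    · have := ih h; omega

theorem length_le_codeSize (l : List α) : l.length ≤ codeSize l := by
  induction l with
  | nil => simp
  | cons a l ih => rw [codeSize_cons, List.length_cons]; omega

theorem codeSize_le_of_forall {l : List α} {N : ℕ} (h : ∀ a ∈ l, codeSize a ≤ N) :
    codeSize l ≤ l.length * (N + 1) + 1 := by
  induction l with
  | nil => simp [codeSize_nil]
  | cons a l ih =>
    have h1 := h a (by simp)
    have h2 := ih fun b hb => h b (by simp [hb])
    rw [codeSize_cons, List.length_cons, add_mul]; omega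

theorem eval_mono (p : Polynomial ℕ) {x y : ℕ} (h : x ≤ y) : p.eval x ≤ p.eval y := by
  rw [Polynomial.eval_eq_sum_range, Polynomial.eval_eq_sum_range]
  gcongr

/-- `f` is computable in polynomial time, with results of polynomial size, by a program that changes
register `0` only. -/
@[fun_prop]
def PolyTime (f : α → β) : Prop :=
  ∃ (P : Cmd) (K : ℕ) (p : Polynomial ℕ), 1 ≤ K ∧ ∀ a,
    Implements P K (p.eval (codeSize a)) (code a) (code (f a)) ∧
      codeSize (f a) ≤ p.eval (codeSize a)

theorem PolyTime.exists_computesWithin {f : α → β} (hf : PolyTime f) :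
    ∃ (P : Cmd) (p : Polynomial ℕ), ∀ a,
      ComputesWithin P (code a) (p.eval (codeSize a)) (code (f a)) := by
  obtain ⟨P, K, p, -, h⟩ := hf
  exact ⟨P, p, fun a => (h a).1.computesWithin⟩

/-- The size bound is a separate hypothesis because time does not imply it: `cons x x x` doubles a
tree in one step, so `t` steps can produce size exponential in `t`. -/
theorem polyTime_of_computesWithin {f : α → β} (P : Cmd) (p q : Polynomial ℕ)
    (h : ∀ a, ComputesWithin P (code a) (p.eval (codeSize a)) (code (f a)))
    (hq : ∀ a, codeSize (f a) ≤ q.eval (codeSize a)) : PolyTime f := by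
  refine ⟨.seq P (clear P.bound), P.bound + 1, p + Polynomial.C (P.bound + 1) + q, Nat.le_add_left 1 P.bound, fun a => ⟨?_, ?_⟩⟩
  · exact (h a).implements.mono le_rfl (by simp)
  · simpa using (hq a).trans (Nat.le_add_left _ _)

/-- Only the codes of the results matter, so computability transfers between types whose elements
share codes. -/
theorem PolyTime.congr_code {f : α → β} (hf : PolyTime f) {g : α → γ}
    (h : ∀ a, code (g a) = code (f a)) : PolyTime g := by
  obtain ⟨P, K, p, hK, hP⟩ := hf
  refine ⟨P, K, p, hK, fun a => ?_⟩
  simpa only [codeSize, h] using hP a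

@[fun_prop]
theorem PolyTime.id : PolyTime fun a : α => a := by
  refine polyTime_of_computesWithin .skip 1 Polynomial.X (fun a => ?_) fun a => by simp
  exact ⟨1, by simp, _, .skip _, by simp⟩

theorem polyTime_of_code_eq {f : α → β} (h : ∀ a, code (f a) = code a) : PolyTime f :=
  PolyTime.id.congr_code h

theorem polyTime_const_data {f : α → β} (d : Data) (h : ∀ a, code (f a) = d) : PolyTime f := by
  have : ∀ d : Data, ∃ (P : Cmd) (K T : ℕ), 1 ≤ K ∧ ∀ e, Implements P K T e d := by
    intro d
    induction d with
    | nil => exact ⟨.setNil 0, 1, 1, le_rfl, fun e => ⟨1, le_rfl, fun s _ _ => .setNil _ _⟩⟩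
    | cons d e ih₁ ih₂ =>
      obtain ⟨P, K, T, hK, hP⟩ := ih₁
      obtain ⟨Q, K', T', hK', hQ⟩ := ih₂
      exact ⟨_, _, _, by omega, fun e => Implements.pair (K := max K K') (by omega)
        ((hP e).mono (le_max_left _ _) le_rfl) ((hQ e).mono (le_max_right _ _) le_rfl)⟩
  obtain ⟨P, K, T, hK, hP⟩ := this d
  refine ⟨P, K, Polynomial.C (T + d.size), hK, fun a => ?_⟩
  rw [codeSize, codeSize, h]
  exact ⟨(hP _).mono le_rfl (by simp), by simp⟩

@[fun_prop]
theorem PolyTime.const (b : β) : PolyTime fun _ : α => b :=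
  polyTime_const_data (code b) fun _ => rfl

@[fun_prop]
theorem PolyTime.comp {g : β → γ} {f : α → β} (hg : PolyTime g) (hf : PolyTime f) :
    PolyTime fun a => g (f a) := by
  obtain ⟨P, K, p, hK, hP⟩ := hf
  obtain ⟨Q, K', q, hK', hQ⟩ := hg
  refine ⟨.seq P Q, max K K', p + q.comp p, by omega, fun a => ⟨?_, ?_⟩⟩
  · have h2 := (hQ (f a)).1.mono (le_max_right K K') (eval_mono q (hP a).2)
    exact (((hP a).1.mono (le_max_left _ _) le_rfl).seq h2).mono le_rfl (by simp)
  · have := (hQ (f a)).2.trans (eval_mono q (hP a).2)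
    simpa using this.trans (Nat.le_add_left _ _)

@[fun_prop]
theorem PolyTime.prodMk {f : α → β} {g : α → γ} (hf : PolyTime f) (hg : PolyTime g) :
    PolyTime fun a => (f a, g a) := by
  obtain ⟨P, K, p, hK, hP⟩ := hf
  obtain ⟨Q, K', q, hK', hQ⟩ := hg
  refine ⟨pairCmd P Q (max K K'), max K K' + 2, p + q + 6, by omega, fun a => ⟨?_, ?_⟩⟩
  · exact (Implements.pair (by omega) ((hP a).1.mono (le_max_left _ _) le_rfl)
      ((hQ a).1.mono (le_max_right _ _) le_rfl)).mono le_rfl (by simp)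
  · have h1 := (hP a).2
    have h2 := (hQ a).2
    rw [codeSize_pair]
    simp only [Polynomial.eval_add, Polynomial.eval_ofNat]
    omega

theorem Data.size_hd_le (d : Data) : d.hd.size ≤ d.size := by
  cases d <;> simp [Data.hd, Data.size]; omega

theorem Data.size_tl_le (d : Data) : d.tl.size ≤ d.size := by
  cases d <;> simp [Data.tl, Data.size]; omega

theorem polyTime_of_hd {f : α → β} (h : ∀ a, code (f a) = (code a).hd) : PolyTime f := by
  refine polyTime_of_computesWithin (.hd 0 0) 1 Polynomial.X (fun a => ?_) fun a => ?_
  · exact ⟨1, by simp, _, .hd _ _ _, by simp [h]⟩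
  · simpa [codeSize, h] using (code a).size_hd_le

theorem polyTime_of_tl {f : α → β} (h : ∀ a, code (f a) = (code a).tl) : PolyTime f := by
  refine polyTime_of_computesWithin (.tl 0 0) 1 Polynomial.X (fun a => ?_) fun a => ?_
  · exact ⟨1, by simp, _, .tl _ _ _, by simp [h]⟩
  · simpa [codeSize, h] using (code a).size_tl_le

theorem polyTime_fst : PolyTime (Prod.fst : α × β → α) := polyTime_of_hd fun _ => rfl

theorem polyTime_snd : PolyTime (Prod.snd : α × β → β) := polyTime_of_tl fun _ => rfl

@[fun_prop]
theorem PolyTime.fst {f : α → β × γ} (hf : PolyTime f) : PolyTime fun a => (f a).1 :=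
  polyTime_fst.comp hf

@[fun_prop]
theorem PolyTime.snd {f : α → β × γ} (hf : PolyTime f) : PolyTime fun a => (f a).2 :=
  polyTime_snd.comp hf

theorem PolyTime.ite_code {c : α → γ} {f g h : α → β} (hc : PolyTime c) (hf : PolyTime f)
    (hg : PolyTime g) (h₁ : ∀ a, code (c a) ≠ .nil → h a = f a)
    (h₂ : ∀ a, code (c a) = .nil → h a = g a) : PolyTime h := by
  obtain ⟨P, K, p, hK, hP⟩ := hc
  obtain ⟨Q, K', q, hK', hQ⟩ := hf
  obtain ⟨R, K'', r, hK'', hR⟩ := hg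
  refine ⟨iteCmd P Q R (max K (max K' K'')), max K (max K' K'') + 2, p + (q + r) + 6, by omega,
    fun a => ⟨?_, ?_⟩⟩
  · refine (Implements.ite (T' := (q + r).eval (codeSize a)) (by omega)
      ((hP a).1.mono (le_max_left _ _) le_rfl) (fun hn => ?_) fun hn => ?_).mono le_rfl (by simp)
    · rw [h₁ a hn]
      exact (hQ a).1.mono (by omega) (by simp)
    · rw [h₂ a hn]
      exact (hR a).1.mono (by omega) (by simp)
  · have h1 := (hQ a).2
    have h2 := (hR a).2
    simp only [Polynomial.eval_add, Polynomial.eval_ofNat]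
    by_cases hn : code (c a) = .nil
    · rw [h₂ a hn]; omega
    · rw [h₁ a hn]; omega

@[fun_prop]
theorem PolyTime.bif {c : α → Bool} {f g : α → β} (hc : PolyTime c) (hf : PolyTime f)
    (hg : PolyTime g) : PolyTime fun a => bif c a then f a else g a :=
  hc.ite_code hf hg (fun a h => by cases hca : c a <;> simp_all [code_false])
    fun a h => by cases hca : c a <;> simp_all [code_true]

/-- Folding a list is possible in polynomial time if each step is and if the intermediate results have
polynomial size. -/
theorem PolyTime.foldl {l : α → List β} {init : α → σ} {step : α → σ → β → σ} (hl : PolyTime l)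
    (hi : PolyTime init) (hs : PolyTime fun x : α × β × σ => step x.1 x.2.2 x.2.1)
    (q : Polynomial ℕ) (hq : ∀ a l', l' <+: l a →
      codeSize (l'.foldl (step a) (init a)) ≤ q.eval (codeSize a)) :
    PolyTime fun a => (l a).foldl (step a) (init a) := by
  have hpre := PolyTime.id.prodMk (hl.prodMk hi)
  obtain ⟨R, K', r, hK', hR⟩ := hpre
  obtain ⟨P, K, p, hK, hP⟩ := hs
  -- A step receives the parameter (size `X`), a list entry (at most `r`) and the accumulator (at
  -- most `q`); the 2 counts the two pair nodes.
  refine ⟨.seq R (foldCmd P (max K K')), max K K' + 3,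
    r + (r * (p.comp (r + q + Polynomial.X + 2) + 7) + 9) + q, by omega, fun a => ⟨?_, ?_⟩⟩
  · have hra := (hR a).2
    simp only [codeSize_pair] at hra
    refine (((hR a).1.mono (by omega) le_rfl).seq (Implements.fold (K := max K K')
      (T := p.eval (r.eval (codeSize a) + q.eval (codeSize a) + codeSize a + 2)) (by omega)
      code code (step a) (code a) (l a) (init a) ?_)).mono le_rfl ?_
    · intro L' b hL
      have h := (hP (a, b, L'.foldl (step a) (init a))).1
      refine h.mono (le_max_left _ _) (eval_mono p ?_)
      have h1 := hq a L' ((List.prefix_append _ _).trans hL)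
      have h2 : codeSize b ≤ codeSize (l a) := codeSize_le_of_mem (hL.subset (by simp))
      simp only [codeSize_pair]
      omega
    · have hlen : (l a).length ≤ r.eval (codeSize a) := by
        have := length_le_codeSize (l a)
        omega
      simp only [Polynomial.eval_add, Polynomial.eval_mul, Polynomial.eval_comp, Polynomial.eval_X,
        Polynomial.eval_ofNat]
      have := Nat.mul_le_mul_right
        (p.eval (r.eval (codeSize a) + q.eval (codeSize a) + codeSize a + 2) + 7) hlen
      omega
  · have := hq a (l a) (List.prefix_refl _)
    simp only [Polynomial.eval_add]
    omega

theorem PolyTime.exists_codeSize_le {f : α → β} (hf : PolyTime f) :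
    ∃ p : Polynomial ℕ, ∀ a, codeSize (f a) ≤ p.eval (codeSize a) := by
  obtain ⟨P, K, p, -, h⟩ := hf
  exact ⟨p, fun a => (h a).2⟩

end

/-! ### Polynomial-time operations on truth values, numbers and lists -/

section

variable {α β γ σ : Type} [Coded α] [Coded β] [Coded γ] [Coded σ]

@[fun_prop]
theorem PolyTime.and {f g : α → Bool} (hf : PolyTime f) (hg : PolyTime g) :
    PolyTime fun a => f a && g a :=
  (hf.bif hg (PolyTime.const false)).congr_code fun a => by cases f a <;> rfl

@[fun_prop]
theorem PolyTime.or {f g : α → Bool} (hf : PolyTime f) (hg : PolyTime g) :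
    PolyTime fun a => f a || g a :=
  (hf.bif (PolyTime.const true) hg).congr_code fun a => by cases f a <;> rfl

@[fun_prop]
theorem PolyTime.bool_beq {f g : α → Bool} (hf : PolyTime f) (hg : PolyTime g) :
    PolyTime fun a => f a == g a :=
  (hf.bif hg (hg.bif (PolyTime.const false) (PolyTime.const true))).congr_code fun a => by
    cases f a <;> cases g a <;> rfl

@[fun_prop]
theorem PolyTime.list_cons {f : α → β} {g : α → List β} (hf : PolyTime f) (hg : PolyTime g) :
    PolyTime fun a => f a :: g a :=
  (hf.prodMk hg).congr_code fun _ => rfl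

@[fun_prop]
theorem PolyTime.list_tail {f : α → List β} (hf : PolyTime f) : PolyTime fun a => (f a).tail :=
  (polyTime_of_tl (f := List.tail) fun l => by cases l <;> rfl).comp hf

theorem foldl_cons_eq_append {ι : Type} (l l' : List ι) :
    l.foldl (fun s b => b :: s) l' = l.reverse ++ l' := by
  induction l generalizing l' with
  | nil => rfl
  | cons b l ih => simp [ih]

@[fun_prop]
theorem PolyTime.list_reverse {f : α → List β} (hf : PolyTime f) :
    PolyTime fun a => (f a).reverse := by
  obtain ⟨p, hp⟩ := hf.exists_codeSize_le
  have := PolyTime.foldl (init := fun _ => []) (step := fun _ s b => b :: s) hf (by fun_prop)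
    (by fun_prop) p fun a l' hl' => by
      rw [foldl_cons_eq_append, List.append_nil, codeSize_reverse]
      exact (codeSize_prefix_le hl').trans (hp a)
  simpa only [foldl_cons_eq_append, List.append_nil] using this

@[fun_prop]
theorem PolyTime.list_append {f g : α → List β} (hf : PolyTime f) (hg : PolyTime g) :
    PolyTime fun a => f a ++ g a := by
  obtain ⟨p, hp⟩ := hf.exists_codeSize_le
  obtain ⟨q, hq⟩ := hg.exists_codeSize_le
  have := PolyTime.foldl (step := fun _ s b => b :: s) hf.list_reverse hg (by fun_prop) (p + q)
    fun a l' hl' => by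
      rw [foldl_cons_eq_append]
      have h1 := codeSize_append l'.reverse (g a)
      have h2 := codeSize_prefix_le hl'
      rw [codeSize_reverse] at h1 h2
      have h3 := hp a
      have h4 := hq a
      rw [Polynomial.eval_add]
      omega
  simpa only [foldl_cons_eq_append, List.reverse_reverse] using this

theorem foldl_append_eq_flatMap {ι κ : Type} (f : ι → List κ) (l : List ι) (l' : List κ) :
    l.foldl (fun s b => s ++ f b) l' = l' ++ l.flatMap f := by
  induction l generalizing l' with
  | nil => simp
  | cons b l ih => simp [ih]

theorem codeSize_flatMap_le {ι : Type} {f : ι → List γ} {l : List ι} {N : ℕ}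
    (h : ∀ b ∈ l, codeSize (f b) ≤ N) : codeSize (l.flatMap f) ≤ l.length * N + 1 := by
  induction l with
  | nil => simp [codeSize_nil]
  | cons b l ih =>
    have h1 := ih fun c hc => h c (by simp [hc])
    have h2 := h b (by simp)
    have h3 := codeSize_append (f b) (l.flatMap f)
    rw [List.flatMap_cons, List.length_cons, add_mul]
    omega

@[fun_prop]
theorem PolyTime.list_flatMap {l : α → List β} {f : α → β → List γ} (hl : PolyTime l)
    (hf : PolyTime fun x : α × β => f x.1 x.2) : PolyTime fun a => (l a).flatMap (f a) := by
  obtain ⟨p, hp⟩ := hl.exists_codeSize_le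
  obtain ⟨q, hq⟩ := hf.exists_codeSize_le
  have := PolyTime.foldl (init := fun _ => []) (step := fun a s b => s ++ f a b) hl (by fun_prop)
    (PolyTime.list_append (by fun_prop) (hf.comp (by fun_prop :
      PolyTime fun x : α × β × List γ => (x.1, x.2.1)))) (p * q.comp (Polynomial.X + p + 1) + 1)
    fun a l' hl' => by
      rw [foldl_append_eq_flatMap, List.nil_append]
      refine (codeSize_flatMap_le (N := q.eval (codeSize a + p.eval (codeSize a) + 1))
        fun b hb => ?_).trans ?_
      · refine (hq (a, b)).trans (eval_mono q ?_)
        have := codeSize_le_of_mem (hl'.subset hb)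
        have := hp a
        rw [codeSize_pair]
        omega
      · have h1 : l'.length ≤ p.eval (codeSize a) :=
          (length_le_codeSize l').trans ((codeSize_prefix_le hl').trans (hp a))
        simpa using Nat.mul_le_mul_right _ h1
  simpa only [foldl_append_eq_flatMap, List.nil_append] using this

@[fun_prop]
theorem PolyTime.list_map {l : α → List β} {f : α → β → γ} (hl : PolyTime l)
    (hf : PolyTime fun x : α × β => f x.1 x.2) : PolyTime fun a => (l a).map (f a) := by
  simp only [List.map_eq_flatMap]
  exact hl.list_flatMap (hf.list_cons (by fun_prop))

@[fun_prop]
theorem PolyTime.list_filter {l : α → List β} {p : α → β → Bool} (hl : PolyTime l)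
    (hp : PolyTime fun x : α × β => p x.1 x.2) : PolyTime fun a => (l a).filter (p a) := by
  have : PolyTime fun a => (l a).flatMap fun b => bif p a b then [b] else [] :=
    hl.list_flatMap (hp.bif (by fun_prop) (by fun_prop))
  refine this.congr_code fun a => congrArg code ?_
  induction l a with
  | nil => rfl
  | cons b l ih => cases h : p a b <;> simp [h, ih]

/-- Unary numbers have the same codes as lists of units, so list operations supply arithmetic. -/
theorem code_nat_eq_replicate (n : ℕ) : code n = code (List.replicate n ()) := by
  simp only [code, List.map_replicate]; rfl

@[fun_prop]
theorem PolyTime.list_replicate {n : α → ℕ} (hn : PolyTime n) :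
    PolyTime fun a => List.replicate (n a) () :=
  (polyTime_of_code_eq fun n => (code_nat_eq_replicate n).symm).comp hn

@[fun_prop]
theorem PolyTime.list_length {l : α → List β} (hl : PolyTime l) : PolyTime fun a => (l a).length :=
  (hl.list_map (PolyTime.const ())).congr_code fun a => by
    rw [code_nat_eq_replicate, List.map_const']

@[fun_prop]
theorem PolyTime.list_countP {l : α → List β} {p : α → β → Bool} (hl : PolyTime l)
    (hp : PolyTime fun x : α × β => p x.1 x.2) : PolyTime fun a => (l a).countP (p a) := by
  simp only [List.countP_eq_length_filter]
  fun_prop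

@[fun_prop]
theorem PolyTime.nat_add {f g : α → ℕ} (hf : PolyTime f) (hg : PolyTime g) :
    PolyTime fun a => f a + g a :=
  (hf.list_replicate.list_append hg.list_replicate).congr_code fun a => by
    rw [code_nat_eq_replicate, List.replicate_add]

@[fun_prop]
theorem PolyTime.nat_mul {f g : α → ℕ} (hf : PolyTime f) (hg : PolyTime g) :
    PolyTime fun a => f a * g a := by
  have : PolyTime fun a => ((List.replicate (f a) ()).flatMap
    fun _ => List.replicate (g a) ()).length := by fun_prop
  simpa using this

theorem foldl_replicate_eq_iterate {ι : Type} (f : ι → ι) (n : ℕ) (s : ι) :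
    (List.replicate n ()).foldl (fun s _ => f s) s = f^[n] s := by
  induction n generalizing s with
  | zero => rfl
  | succ n ih => rw [List.replicate_succ, List.foldl_cons, ih, Function.iterate_succ_apply]

/-- Iteration is a fold over a list of `n a` units. The size of every partial iterate must be
bounded, since composing polynomial bounds along a variable number of steps gives no polynomial. -/
theorem PolyTime.iterate {n : α → ℕ} {init : α → σ} {step : α → σ → σ} (hn : PolyTime n)
    (hi : PolyTime init) (hs : PolyTime fun x : α × σ => step x.1 x.2) (q : Polynomial ℕ)
    (hq : ∀ a, ∀ i ≤ n a, codeSize ((step a)^[i] (init a)) ≤ q.eval (codeSize a)) :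
    PolyTime fun a => (step a)^[n a] (init a) := by
  have := PolyTime.foldl (step := fun a s (_ : Unit) => step a s) hn.list_replicate hi
    (hs.comp (by fun_prop : PolyTime fun x : α × Unit × σ => (x.1, x.2.2))) q fun a l' hl' => by
      rw [List.prefix_replicate_iff] at hl'
      rw [hl'.2, foldl_replicate_eq_iterate]
      exact hq a _ hl'.1
  simpa only [foldl_replicate_eq_iterate] using this

@[fun_prop]
theorem PolyTime.nat_pred {f : α → ℕ} (hf : PolyTime f) : PolyTime fun a => (f a).pred :=
  (polyTime_of_tl (f := Nat.pred) fun n => by cases n <;> rfl).comp hf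

@[fun_prop]
theorem PolyTime.nat_sub {f g : α → ℕ} (hf : PolyTime f) (hg : PolyTime g) :
    PolyTime fun a => f a - g a := by
  obtain ⟨p, hp⟩ := hf.exists_codeSize_le
  have key : ∀ i m, Nat.pred^[i] m = m - i := fun i m => Nat.pred_iterate m i
  have := PolyTime.iterate (step := fun _ n => Nat.pred n) hg hf (by fun_prop) p fun a i _ => by
    have := hp a
    rw [key]
    rw [codeSize_nat] at this ⊢
    omega
  simpa only [key] using this

@[fun_prop]
theorem PolyTime.nat_le {f g : α → ℕ} (hf : PolyTime f) (hg : PolyTime g) :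
    PolyTime fun a => decide (f a ≤ g a) := by
  refine (hf.nat_sub hg).ite_code (PolyTime.const false) (PolyTime.const true) (fun a h => ?_)
    fun a h => ?_
  · rw [decide_eq_false_iff_not]
    intro hle
    rw [Nat.sub_eq_zero_of_le hle] at h
    exact h rfl
  · rw [decide_eq_true_iff]
    rcases hn : f a - g a with _ | n
    · omega
    · rw [hn] at h; cases h

@[fun_prop]
theorem PolyTime.nat_lt {f g : α → ℕ} (hf : PolyTime f) (hg : PolyTime g) :
    PolyTime fun a => decide (f a < g a) := by
  simp only [Nat.lt_iff_add_one_le]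
  fun_prop

@[fun_prop]
theorem PolyTime.nat_beq {f g : α → ℕ} (hf : PolyTime f) (hg : PolyTime g) :
    PolyTime fun a => f a == g a := by
  have : PolyTime fun a => decide (f a ≤ g a) && decide (g a ≤ f a) := by fun_prop
  refine this.congr_code fun a => congrArg code ?_
  rw [Bool.eq_iff_iff]
  simp only [beq_iff_eq, Bool.and_eq_true, decide_eq_true_iff]
  omega

@[fun_prop]
theorem PolyTime.list_range {n : α → ℕ} (hn : PolyTime n) : PolyTime fun a => List.range (n a) := by
  -- Prepending the current length counts upwards, which builds the range in reverse.
  have key : ∀ i, (fun l : List ℕ => l.length :: l)^[i] [] = (List.range i).reverse := by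
    intro i
    induction i with
    | zero => rfl
    | succ i ih => simp [Function.iterate_succ_apply', ih, List.range_succ]
  obtain ⟨p, hp⟩ := hn.exists_codeSize_le
  have := (PolyTime.iterate (init := fun _ => []) (step := fun _ (l : List ℕ) => l.length :: l) hn
    (by fun_prop) (by fun_prop) (p * (p + 1) + 1) fun a i hi => ?_).list_reverse
  · simpa only [key, List.reverse_reverse] using this
  · have h1 := hp a
    rw [codeSize_nat] at h1
    rw [key]
    refine (codeSize_le_of_forall (N := p.eval (codeSize a)) fun m hm => ?_).trans ?_
    · simp only [List.mem_reverse, List.mem_range] at hm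
      rw [codeSize_nat]
      omega
    · simp only [List.length_reverse, List.length_range, Polynomial.eval_add,
        Polynomial.eval_mul, Polynomial.eval_one]
      have := Nat.mul_le_mul_right (p.eval (codeSize a) + 1) (show i ≤ p.eval (codeSize a) by omega)
      omega

@[fun_prop]
theorem PolyTime.list_drop {l : α → List β} {n : α → ℕ} (hl : PolyTime l) (hn : PolyTime n) :
    PolyTime fun a => (l a).drop (n a) := by
  obtain ⟨p, hp⟩ := hl.exists_codeSize_le
  have key : ∀ i, ∀ m : List β, List.tail^[i] m = m.drop i := by
    intro i
    induction i with
    | zero => simp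
    | succ i ih => intro m; rw [Function.iterate_succ_apply, ih, List.drop_tail]
  have := PolyTime.iterate (step := fun _ (m : List β) => m.tail) hn hl (by fun_prop) p
    fun a i _ => by
      rw [key]
      have h1 := codeSize_append ((l a).take i) ((l a).drop i)
      have h2 := codeSize_pos ((l a).take i)
      have h3 := hp a
      rw [List.take_append_drop] at h1
      omega
  simpa only [key] using this

/-- The entry is the head of a dropped list. As `hd` of `nil` is `nil`, the default must be coded by
`nil`. -/
theorem PolyTime.list_getD {l : α → List β} {n : α → ℕ} {d : β} (hd : code d = .nil)
    (hl : PolyTime l) (hn : PolyTime n) : PolyTime fun a => (l a).getD (n a) d := by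
  have : PolyTime fun m : List β => m.headD d :=
    polyTime_of_hd fun m => by cases m; exacts [hd, rfl]
  refine (this.comp (hl.list_drop hn)).congr_code fun a => congrArg code ?_
  rw [List.headD_eq_head?_getD, List.head?_drop, List.getD_eq_getElem?_getD]

@[fun_prop]
theorem PolyTime.list_getD_false {l : α → List Bool} {n : α → ℕ} (hl : PolyTime l)
    (hn : PolyTime n) : PolyTime fun a => (l a).getD (n a) false :=
  hl.list_getD code_false hn

@[fun_prop]
theorem PolyTime.list_getD_nil {l : α → List (List β)} {n : α → ℕ} (hl : PolyTime l)
    (hn : PolyTime n) : PolyTime fun a => (l a).getD (n a) [] :=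
  hl.list_getD code_nil hn

@[fun_prop]
theorem PolyTime.list_headD_nil {l : α → List (List β)} (hl : PolyTime l) :
    PolyTime fun a => (l a).headD [] :=
  (polyTime_of_hd (f := fun m : List (List β) => m.headD []) fun m => by cases m <;> rfl).comp hl

end

/-! ### The algorithm for the densest subgraph problem

Graphs are given by lists of rows of their adjacency matrices, sets of vertices by characteristic
vectors. -/

/-- The entry of a 0/1 matrix in row `u` and column `v`. -/
def entry (M : List (List Bool)) (u v : ℕ) : Bool := (M.getD u []).getD v false

/-- The list of all pairs of numbers below `n`. -/
def pairs (n : ℕ) : List (ℕ × ℕ) := (List.range n).flatMap fun u => (List.range n).map fun v => (u, v)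

/-- The number of ordered pairs of adjacent vertices in `W`. -/
def listEdges (M : List (List Bool)) (W : List Bool) : ℕ :=
  (pairs M.length).countP fun x => entry M x.1 x.2 && (W.getD x.1 false && W.getD x.2 false)

/-- The matrix of the bipartite graph of the reduction: each vertex `w` has `4 n` copies, which are
adjacent to the ordered pairs of adjacent vertices of which `w` is a member. -/
def listModel (M : List (List Bool)) : List (List Bool) :=
  (List.range M.length).flatMap fun w => (List.range (4 * M.length)).map fun _ =>
    (pairs M.length).map fun x => entry M x.1 x.2 && (w == x.1 || w == x.2)

/-- The set of vertices of which more than half of the copies belong to `X`. -/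
def listMajority (n : ℕ) (X : List Bool) : List Bool :=
  (List.range n).map fun w => decide
    (2 * n < (List.range (4 * n)).countP fun j => X.getD (w * (4 * n) + j) false)

/-- The number of elements of a set of vertices. -/
def listCard (n : ℕ) (W : List Bool) : ℕ := (List.range n).countP fun v => W.getD v false

/-- The set obtained from `W` by inserting or deleting `v`. -/
def toggle (n : ℕ) (W : List Bool) (v : ℕ) : List Bool :=
  (List.range n).map fun u => bif u == v then bif W.getD u false then false else true
    else W.getD u false

/-- The first set in the list `l` with a maximum number of edges. -/
def bestOf (M : List (List Bool)) (l : List (List Bool)) : List Bool :=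
  l.foldl (fun s c => bif decide (listEdges M s < listEdges M c) then c else s) (l.headD [])

/-- The vertices to be inserted or deleted in order that `W` gets closer to having `k` elements. -/
def toggleable (n k : ℕ) (W : List Bool) : List ℕ :=
  (List.range n).filter fun v => W.getD v false == decide (k < listCard n W)

/-- The best set obtained from `W` by one insertion or deletion that brings its cardinality closer
to `k`. -/
def adjust (M : List (List Bool)) (k : ℕ) (W : List Bool) : List Bool :=
  bif listCard M.length W == k then W
  else bestOf M ((toggleable M.length k W).map (toggle M.length W))

/-- The set of `k` vertices obtained from `W` by adjusting it greedily. -/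
def resize (M : List (List Bool)) (k : ℕ) (W : List Bool) : List Bool :=
  (adjust M k)^[M.length] W

/-- The best of the sets of `k` vertices obtained from the sets of rows in the list `L`. -/
def bestResized (M : List (List Bool)) (k : ℕ) (L : List (List Bool)) : List Bool :=
  bestOf M (([] :: L).map fun X => resize M k (listMajority M.length X))

/-- The instances of the rank reduction problem to be solved. -/
def queries (M : List (List Bool)) : List (List (List Bool) × ℕ) :=
  (List.range (listEdges M ((List.range M.length).map fun _ => true))).map fun l =>
    (listModel M, l + 1)

/-! ### Polynomial running time of the algorithm's components -/

section

variable {α : Type} [Coded α]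

@[fun_prop]
theorem PolyTime.entry {M : α → List (List Bool)} {u v : α → ℕ} (hM : PolyTime M) (hu : PolyTime u)
    (hv : PolyTime v) : PolyTime fun a => entry (M a) (u a) (v a) := by
  unfold RankReduction.entry
  fun_prop

@[fun_prop]
theorem PolyTime.pairs {n : α → ℕ} (hn : PolyTime n) : PolyTime fun a => pairs (n a) := by
  unfold RankReduction.pairs
  fun_prop

@[fun_prop]
theorem PolyTime.listEdges {M : α → List (List Bool)} {W : α → List Bool} (hM : PolyTime M)
    (hW : PolyTime W) : PolyTime fun a => listEdges (M a) (W a) := by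
  unfold RankReduction.listEdges
  fun_prop

@[fun_prop]
theorem PolyTime.listModel {M : α → List (List Bool)} (hM : PolyTime M) :
    PolyTime fun a => listModel (M a) := by
  unfold RankReduction.listModel
  fun_prop

@[fun_prop]
theorem PolyTime.listMajority {n : α → ℕ} {X : α → List Bool} (hn : PolyTime n)
    (hX : PolyTime X) : PolyTime fun a => listMajority (n a) (X a) := by
  unfold RankReduction.listMajority
  fun_prop

@[fun_prop]
theorem PolyTime.listCard {n : α → ℕ} {W : α → List Bool} (hn : PolyTime n)
    (hW : PolyTime W) : PolyTime fun a => listCard (n a) (W a) := by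
  unfold RankReduction.listCard
  fun_prop

@[fun_prop]
theorem PolyTime.toggle {n v : α → ℕ} {W : α → List Bool} (hn : PolyTime n)
    (hW : PolyTime W) (hv : PolyTime v) : PolyTime fun a => toggle (n a) (W a) (v a) := by
  unfold RankReduction.toggle
  fun_prop

/-- A fold that only selects never leaves the candidates; this bounds the size of the winner and
transfers to it every property shared by all candidates. -/
theorem foldl_bif_mem {ι : Type} (p : ι → ι → Bool) (l : List ι) (i : ι) :
    l.foldl (fun s c => bif p s c then c else s) i ∈ i :: l := by
  induction l generalizing i with
  | nil => simp
  | cons c l ih =>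
    rw [List.foldl_cons]
    rcases List.mem_cons.1 (ih (bif p i c then c else i)) with h | h
    · rw [h]; cases p i c <;> simp
    · simp [h]

theorem bestOf_mem (M : List (List Bool)) {l : List (List Bool)} (hl : l ≠ []) : bestOf M l ∈ l := by
  have := foldl_bif_mem (fun s c => decide (listEdges M s < listEdges M c)) l (l.headD [])
  cases l with
  | nil => exact absurd rfl hl
  | cons c l => simpa [bestOf] using this

theorem bestOf_nil (M : List (List Bool)) : bestOf M [] = [] := rfl

@[fun_prop]
theorem PolyTime.bestOf {M l : α → List (List Bool)} (hM : PolyTime M) (hl : PolyTime l) :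
    PolyTime fun a => bestOf (M a) (l a) := by
  obtain ⟨p, hp⟩ := hl.exists_codeSize_le
  unfold RankReduction.bestOf
  refine PolyTime.foldl (step := fun a s c =>
    bif decide (RankReduction.listEdges (M a) s < RankReduction.listEdges (M a) c) then c else s)
    hl (by fun_prop) (by fun_prop) p fun a l' hl' => ?_
  have h1 := foldl_bif_mem (fun s c => decide
    (RankReduction.listEdges (M a) s < RankReduction.listEdges (M a) c)) l' ((l a).headD [])
  rcases List.mem_cons.1 h1 with h2 | h2
  · rw [h2]
    refine le_trans ?_ (hp a)
    rcases hla : l a with _ | ⟨c, m⟩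
    · rfl
    · exact codeSize_le_of_mem (by simp)
  · exact (codeSize_le_of_mem (hl'.subset h2)).trans (hp a)

@[fun_prop]
theorem PolyTime.toggleable {n k : α → ℕ} {W : α → List Bool} (hn : PolyTime n) (hk : PolyTime k)
    (hW : PolyTime W) : PolyTime fun a => toggleable (n a) (k a) (W a) := by
  unfold RankReduction.toggleable
  fun_prop

@[fun_prop]
theorem PolyTime.adjust {M : α → List (List Bool)} {k : α → ℕ} {W : α → List Bool}
    (hM : PolyTime M) (hk : PolyTime k) (hW : PolyTime W) :
    PolyTime fun a => adjust (M a) (k a) (W a) := by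
  unfold RankReduction.adjust
  fun_prop

/-- The result is either the old vector or a Boolean vector of length at most `M.length`, so sizes
stay bounded however often the adjustment is iterated. -/
theorem codeSize_adjust_le (M : List (List Bool)) (k : ℕ) (W : List Bool) :
    codeSize (adjust M k W) ≤ max (codeSize W) (4 * M.length + 1) := by
  unfold adjust
  cases listCard M.length W == k
  · refine le_trans ?_ (le_max_right _ _)
    rw [cond_false]
    by_cases h : (toggleable M.length k W).map (toggle M.length W) = []
    · rw [h, bestOf_nil, codeSize_nil]; omega
    · obtain ⟨v, -, hv⟩ := List.mem_map.1 (bestOf_mem M h)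
      rw [← hv]
      refine (codeSize_le_of_forall (N := 3) fun b _ => codeSize_bool_le b).trans ?_
      simp [toggle]
      omega
  · exact le_max_left _ _

@[fun_prop]
theorem PolyTime.resize {M : α → List (List Bool)} {k : α → ℕ} {W : α → List Bool}
    (hM : PolyTime M) (hk : PolyTime k) (hW : PolyTime W) :
    PolyTime fun a => resize (M a) (k a) (W a) := by
  obtain ⟨p, hp⟩ := hM.exists_codeSize_le
  obtain ⟨q, hq⟩ := hW.exists_codeSize_le
  unfold RankReduction.resize
  refine PolyTime.iterate (step := fun a W => RankReduction.adjust (M a) (k a) W) (by fun_prop) hW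
    (by fun_prop) (q + (4 * p + 1)) fun a i _ => ?_
  have h1 := length_le_codeSize (M a)
  have h2 := hp a
  have h3 := hq a
  have h4 : codeSize ((RankReduction.adjust (M a) (k a))^[i] (W a)) ≤
      max (codeSize (W a)) (4 * (M a).length + 1) := by
    induction i with
    | zero => exact le_max_left _ _
    | succ i ih =>
      rw [Function.iterate_succ_apply']
      have := codeSize_adjust_le (M a) (k a) ((RankReduction.adjust (M a) (k a))^[i] (W a))
      omega
  simp only [Polynomial.eval_add, Polynomial.eval_mul, Polynomial.eval_ofNat, Polynomial.eval_one]
  exact h4.trans (by omega)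

@[fun_prop]
theorem PolyTime.bestResized {M L : α → List (List Bool)} {k : α → ℕ} (hM : PolyTime M)
    (hk : PolyTime k) (hL : PolyTime L) : PolyTime fun a => bestResized (M a) (k a) (L a) := by
  unfold RankReduction.bestResized
  fun_prop

@[fun_prop]
theorem PolyTime.queries {M : α → List (List Bool)} (hM : PolyTime M) :
    PolyTime fun a => queries (M a) := by
  unfold RankReduction.queries
  fun_prop

end

/-! ### Ranks in transversal matroids -/

section

variable {α β γ : Type*} [Finite α] {H : α → β → Prop}

/-- A matching gives a lower bound for the rank. -/
theorem card_le_eRk_of_matching (C : Finset γ) (row : γ → α) (col : γ → β) {Y : Set α}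
    (hrow : Set.InjOn row C) (hcol : Set.InjOn col C) (hH : ∀ x ∈ C, H (row x) (col x))
    (hY : ∀ x ∈ C, row x ∈ Y) : (C.card : ℕ∞) ≤ (transversalMatroid H).eRk Y := by
  have hI : (transversalMatroid H).Indep (row '' C) := by
    rw [transversalMatroid_indep]
    choose f hf using fun y : row '' (C : Set γ) => y.2
    refine ⟨fun y => col (f y), fun y z hyz => ?_, fun y => ?_⟩
    · apply Subtype.ext
      rw [← (hf y).2, ← (hf z).2, hcol (hf y).1 (hf z).1 hyz]
    · have := hH _ (hf y).1
      rwa [(hf y).2] at this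
  have := hI.encard_le_eRk_of_subset (X := Y) (by rintro _ ⟨x, hx, rfl⟩; exact hY x hx)
  rwa [hrow.encard_image, Set.encard_coe_eq_coe_finsetCard] at this

/-- A set that contains all neighbours of `Y` gives an upper bound for the rank of `Y`. -/
theorem eRk_le_card_of_neighbors (C : Finset β) {Y : Set α} (h : ∀ x ∈ Y, ∀ c, H x c → c ∈ C) :
    (transversalMatroid H).eRk Y ≤ C.card := by
  rw [Matroid.eRk_le_iff]
  intro I hI hind
  obtain ⟨f, hf, hH⟩ := (transversalMatroid_indep H I).1 hind
  rw [← Set.encard_coe_eq_coe_finsetCard]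
  have h1 : (Set.range f).encard = I.encard := by
    rw [← Set.image_univ, hf.encard_image, Set.encard_univ, Set.encard]
  rw [← h1]
  exact Set.encard_le_encard (by rintro _ ⟨x, rfl⟩; exact h x (hI x.2) _ (hH x))

end

/-! ### The reduction -/

section

variable {n : ℕ}

open Classical in
/-- The ordered pairs of adjacent vertices in `S`. -/
noncomputable def orderedEdges (G : SimpleGraph (Fin n)) (S : Finset (Fin n)) :
    Finset (Fin n × Fin n) :=
  Finset.univ.filter fun x => G.Adj x.1 x.2 ∧ x.1 ∈ S ∧ x.2 ∈ S

theorem mem_orderedEdges {G : SimpleGraph (Fin n)} {S : Finset (Fin n)} {x : Fin n × Fin n} :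
    x ∈ orderedEdges G S ↔ G.Adj x.1 x.2 ∧ x.1 ∈ S ∧ x.2 ∈ S := by
  simp [orderedEdges]

theorem orderedEdges_mono (G : SimpleGraph (Fin n)) {S T : Finset (Fin n)} (h : S ⊆ T) :
    orderedEdges G S ⊆ orderedEdges G T := fun x hx => by
  rw [mem_orderedEdges] at hx ⊢
  exact ⟨hx.1, h hx.2.1, h hx.2.2⟩

/-- The ordered pairs are the darts of the induced graph, and each edge carries two darts. -/
theorem card_orderedEdges (G : SimpleGraph (Fin n)) (S : Finset (Fin n)) :
    (orderedEdges G S).card = 2 * inducedEdges G S := by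
  classical
  let e : (G.induce (S : Set (Fin n))).Dart ≃ {x // x ∈ orderedEdges G S} :=
    { toFun := fun d => ⟨(d.fst.1, d.snd.1), mem_orderedEdges.2 ⟨d.adj, d.fst.2, d.snd.2⟩⟩
      invFun := fun x => ⟨(⟨x.1.1, (mem_orderedEdges.1 x.2).2.1⟩,
        ⟨x.1.2, (mem_orderedEdges.1 x.2).2.2⟩), (mem_orderedEdges.1 x.2).1⟩
      left_inv := fun _ => rfl
      right_inv := fun _ => rfl }
  rw [← Fintype.card_coe, ← Fintype.card_congr e, SimpleGraph.dart_card_eq_twice_card_edges,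
    inducedEdges, ← SimpleGraph.coe_edgeFinset, Set.ncard_coe_finset]

/-- The vertex of which a row is a copy. -/
def baseVertex (i : Fin (n * (4 * n))) : Fin n := (finProdFinEquiv.symm i).1

/-- The bipartite graph of the reduction: each vertex `w` has `4 n` copies, which are adjacent to the
ordered pairs of adjacent vertices of which `w` is a member. -/
def copyModel (G : SimpleGraph (Fin n)) (i : Fin (n * (4 * n))) (c : Fin (n * n)) : Prop :=
  G.Adj (finProdFinEquiv.symm c).1 (finProdFinEquiv.symm c).2 ∧
    (baseVertex i = (finProdFinEquiv.symm c).1 ∨ baseVertex i = (finProdFinEquiv.symm c).2)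

/-- The copies of the elements of `S`. -/
def copiesOf (S : Finset (Fin n)) : Finset (Fin (n * (4 * n))) :=
  Finset.univ.filter fun i => baseVertex i ∈ S

/-- The vertices of which more than half of the copies belong to `X`. -/
def majority (X : Finset (Fin (n * (4 * n)))) : Finset (Fin n) :=
  Finset.univ.filter fun w => 2 * n < (X.filter fun i => baseVertex i = w).card

theorem baseVertex_finProdFinEquiv (w : Fin n) (j : Fin (4 * n)) :
    baseVertex (finProdFinEquiv (w, j)) = w :=
  congrArg Prod.fst (finProdFinEquiv.symm_apply_apply (w, j))

theorem card_filter_baseVertex (p : Fin (n * (4 * n)) → Prop) [DecidablePred p] (w : Fin n) :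
    ((Finset.univ.filter p).filter fun i => baseVertex i = w).card =
      (Finset.univ.filter fun j : Fin (4 * n) => p (finProdFinEquiv (w, j))).card := by
  symm
  refine Finset.card_bij (fun j _ => finProdFinEquiv (w, j)) (fun j hj => ?_) (fun j _ j' _ h => ?_)
    fun i hi => ?_
  · simpa [baseVertex_finProdFinEquiv] using hj
  · simpa using h
  · simp only [Finset.mem_filter, Finset.mem_univ, true_and] at hi
    have : finProdFinEquiv (w, (finProdFinEquiv.symm i).2) = i := by
      rw [← hi.2]
      exact finProdFinEquiv.apply_symm_apply i
    refine ⟨(finProdFinEquiv.symm i).2, ?_, this⟩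
    rw [Finset.mem_filter, this]
    exact ⟨Finset.mem_univ _, hi.1⟩

theorem card_baseVertex_eq (w : Fin n) :
    (Finset.univ.filter fun i : Fin (n * (4 * n)) => baseVertex i = w).card = 4 * n := by
  have := card_filter_baseVertex (fun _ => True) w
  simpa using this

theorem card_copiesOf (S : Finset (Fin n)) : (copiesOf S).card = 4 * n * S.card := by
  rw [Finset.card_eq_sum_card_fiberwise (f := baseVertex) (t := S) fun i hi => by
    simpa [copiesOf] using hi]
  rw [Finset.sum_congr rfl fun w hw => ?_, Finset.sum_const, smul_eq_mul, mul_comm]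
  refine Eq.trans (congrArg Finset.card ?_) (card_baseVertex_eq w)
  ext i
  simp only [copiesOf, Finset.mem_filter, Finset.mem_univ, true_and]
  exact ⟨fun h => h.2, fun h => ⟨h ▸ hw, h⟩⟩

/-- Each majority vertex accounts for more than `2 * n` elements of `X`, and copies of different
vertices are different. -/
theorem card_majority_le (X : Finset (Fin (n * (4 * n)))) :
    2 * n * (majority X).card ≤ X.card := by
  rw [Finset.card_eq_sum_card_fiberwise (f := baseVertex) (t := Finset.univ) (fun _ _ => by simp)]
  calc 2 * n * (majority X).card = ∑ w ∈ majority X, 2 * n := by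
        rw [Finset.sum_const, smul_eq_mul, mul_comm]
    _ ≤ ∑ w ∈ majority X, (X.filter fun i => baseVertex i = w).card :=
        Finset.sum_le_sum fun w hw => by
          rw [majority, Finset.mem_filter] at hw
          exact hw.2.le
    _ ≤ _ := Finset.sum_le_sum_of_subset (Finset.subset_univ _)

/-- Match the pair `(u, v)` with copy number `v` of `u`. -/
theorem card_orderedEdges_le_eRank (G : SimpleGraph (Fin n)) :
    ((orderedEdges G Finset.univ).card : ℕ∞) ≤ (transversalMatroid (copyModel G)).eRank := by
  rw [← Matroid.eRk_univ_eq]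
  refine card_le_eRk_of_matching _ (fun x => finProdFinEquiv (x.1, ⟨x.2, by omega⟩)) finProdFinEquiv
    (fun x _ y _ h => ?_) finProdFinEquiv.injective.injOn (fun x hx => ?_) fun _ _ => trivial
  · simp only [EmbeddingLike.apply_eq_iff_eq, Prod.mk.injEq, Fin.mk.injEq] at h
    exact Prod.ext h.1 (Fin.ext h.2)
  · simpa [copyModel, baseVertex] using (mem_orderedEdges.1 hx).1

/-- A copy of a vertex outside `S` is adjacent only to pairs not contained in `S`. -/
theorem eRk_le_card_orderedEdges (G : SimpleGraph (Fin n)) (S : Finset (Fin n))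
    {Y : Set (Fin (n * (4 * n)))} (hY : ∀ i ∈ Y, baseVertex i ∉ S) :
    (transversalMatroid (copyModel G)).eRk Y ≤
      ((orderedEdges G Finset.univ \ orderedEdges G S).card : ℕ∞) := by
  refine (eRk_le_card_of_neighbors (Finset.image finProdFinEquiv
    (orderedEdges G Finset.univ \ orderedEdges G S)) fun i hi c hc => ?_).trans
    (by exact_mod_cast Finset.card_image_le)
  refine Finset.mem_image.2 ⟨finProdFinEquiv.symm c, ?_, finProdFinEquiv.apply_symm_apply c⟩
  rw [Finset.mem_sdiff, mem_orderedEdges, mem_orderedEdges]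
  refine ⟨⟨hc.1, by simp, by simp⟩, fun h => ?_⟩
  rcases hc.2 with h' | h'
  · exact hY i hi (h' ▸ h.2.1)
  · exact hY i hi (h' ▸ h.2.2)

theorem card_sdiff_orderedEdges (G : SimpleGraph (Fin n)) (S : Finset (Fin n)) :
    (orderedEdges G Finset.univ \ orderedEdges G S).card + (orderedEdges G S).card =
      (orderedEdges G Finset.univ).card :=
  Finset.card_sdiff_add_card_eq_card (orderedEdges_mono G (Finset.subset_univ S))

/-- Removing all copies of the vertices in `S` reduces the rank by the number of edges in `S`. -/
theorem reducesRank_copiesOf (G : SimpleGraph (Fin n)) (S : Finset (Fin n)) {l : ℕ}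
    (hl : l ≤ (orderedEdges G S).card) :
    ReducesRank (transversalMatroid (copyModel G)) l (copiesOf S : Set (Fin (n * (4 * n)))) := by
  refine ⟨fun _ _ => trivial, ?_⟩
  rw [Matroid.eRk_ground]
  refine le_trans ?_ (card_orderedEdges_le_eRank G)
  rw [← card_sdiff_orderedEdges G S, Nat.cast_add]
  refine add_le_add (eRk_le_card_orderedEdges G S fun i hi => ?_) (by exact_mod_cast hl)
  simpa [copiesOf] using hi.2

/-- The edges that are not contained in the majority set of `X` can be matched into the complement
of `X`. -/
theorem card_sdiff_majority_le_eRk (G : SimpleGraph (Fin n)) (X : Finset (Fin (n * (4 * n)))) :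
    ((orderedEdges G Finset.univ \ orderedEdges G (majority X)).card : ℕ∞) ≤
      (transversalMatroid (copyModel G)).eRk (Set.univ \ (X : Set (Fin (n * (4 * n))))) := by
  classical
  -- A vertex outside the majority has at least `4 * n - 2 * n` copies outside `X`: one slot for
  -- each other endpoint and each orientation of a pair. For majority vertices the map is a dummy.
  have hfree : ∀ w, ∃ φ : Fin n × Bool → Fin (n * (4 * n)), w ∉ majority X →
      Function.Injective φ ∧ ∀ y, baseVertex (φ y) = w ∧ φ y ∉ X := by
    intro w
    by_cases hw : w ∈ majority X
    · refine ⟨fun y => finProdFinEquiv (w, ⟨y.1, by omega⟩), fun h => absurd hw h⟩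
    set F := (Finset.univ.filter fun i : Fin (n * (4 * n)) => baseVertex i = w) \
      X.filter fun i => baseVertex i = w with hF
    have hcard : Fintype.card (Fin n × Bool) ≤ Fintype.card F := by
      have h1 := Finset.le_card_sdiff (X.filter fun i => baseVertex i = w)
        (Finset.univ.filter fun i : Fin (n * (4 * n)) => baseVertex i = w)
      rw [card_baseVertex_eq] at h1
      have h2 : ¬ 2 * n < (X.filter fun i => baseVertex i = w).card := by
        simpa [majority] using hw
      rw [Fintype.card_coe, hF, Fintype.card_prod, Fintype.card_fin, Fintype.card_bool]
      omega
    obtain ⟨φ⟩ := Function.Embedding.nonempty_of_card_le hcard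
    refine ⟨fun y => φ y, fun _ => ⟨fun y z h => φ.injective (Subtype.ext h), fun y => ?_⟩⟩
    have := (φ y).2
    simp only [hF, Finset.mem_sdiff, Finset.mem_filter, Finset.mem_univ, true_and] at this
    exact ⟨this.1, fun h => this.2 ⟨h, this.1⟩⟩
  choose φ hφ using hfree
  have hout : ∀ x ∈ orderedEdges G Finset.univ \ orderedEdges G (majority X),
      G.Adj x.1 x.2 ∧ (x.1 ∈ majority X → x.2 ∉ majority X) := by
    intro x hx
    rw [Finset.mem_sdiff, mem_orderedEdges, mem_orderedEdges] at hx
    exact ⟨hx.1.1, fun h1 h2 => hx.2 ⟨hx.1.1, h1, h2⟩⟩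
  -- Each pair uses a free copy of an endpoint outside the majority. The slot records the other
  -- endpoint, and the Boolean tells whether the copied vertex is the second one, so the pair can be
  -- recovered from the copy.
  refine card_le_eRk_of_matching _ (fun x => if x.1 ∈ majority X then φ x.2 (x.1, true)
    else φ x.1 (x.2, false)) finProdFinEquiv (fun x hx y hy h => ?_)
    finProdFinEquiv.injective.injOn (fun x hx => ?_) fun x hx => ?_
  · have hx' := (hout x hx).2
    have hy' := (hout y hy).2
    by_cases h1 : x.1 ∈ majority X <;> by_cases h2 : y.1 ∈ majority X <;>
      simp only [h1, h2, if_true, if_false] at h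
    · have e : x.2 = y.2 := by
        rw [← ((hφ _ (hx' h1)).2 (x.1, true)).1, h, ((hφ _ (hy' h2)).2 (y.1, true)).1]
      rw [e] at h
      exact Prod.ext (Prod.mk.inj ((hφ _ (hy' h2)).1 h)).1 e
    · have e : x.2 = y.1 := by
        rw [← ((hφ _ (hx' h1)).2 (x.1, true)).1, h, ((hφ _ h2).2 (y.2, false)).1]
      rw [e] at h
      exact absurd (Prod.mk.inj ((hφ _ h2).1 h)).2 (by simp)
    · have e : x.1 = y.2 := by
        rw [← ((hφ _ h1).2 (x.2, false)).1, h, ((hφ _ (hy' h2)).2 (y.1, true)).1]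
      rw [e] at h
      exact absurd (Prod.mk.inj ((hφ _ (hy' h2)).1 h)).2 (by simp)
    · have e : x.1 = y.1 := by
        rw [← ((hφ _ h1).2 (x.2, false)).1, h, ((hφ _ h2).2 (y.2, false)).1]
      rw [e] at h
      exact Prod.ext e (Prod.mk.inj ((hφ _ h2).1 h)).1
  · have hx' := hout x hx
    by_cases h1 : x.1 ∈ majority X
    · simp [copyModel, h1, hx'.1, ((hφ _ (hx'.2 h1)).2 (x.1, true)).1]
    · simp [copyModel, h1, hx'.1, ((hφ _ h1).2 (x.2, false)).1]
  · have hx' := hout x hx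
    by_cases h1 : x.1 ∈ majority X
    · simp [h1, ((hφ _ (hx'.2 h1)).2 (x.1, true)).2]
    · simp [h1, ((hφ _ h1).2 (x.2, false)).2]

/-- If removing `X` reduces the rank by `l`, then the majority set of `X` contains at least `l` ordered
pairs of adjacent vertices. -/
theorem le_card_orderedEdges_majority (G : SimpleGraph (Fin n)) {X : Finset (Fin (n * (4 * n)))}
    {l : ℕ} (h : ReducesRank (transversalMatroid (copyModel G)) l (X : Set (Fin (n * (4 * n))))) :
    l ≤ (orderedEdges G (majority X)).card := by
  have h1 := card_sdiff_majority_le_eRk G X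
  -- With the empty set this bounds the full rank by the number of all ordered pairs.
  have h2 := eRk_le_card_orderedEdges G ∅ (Y := Set.univ) (by simp)
  have h3 := card_sdiff_orderedEdges G ∅
  have h4 := card_sdiff_orderedEdges G (majority X)
  have h5 : ((orderedEdges G Finset.univ \ orderedEdges G (majority X)).card : ℕ∞) + l ≤
      ((orderedEdges G Finset.univ \ orderedEdges G ∅).card : ℕ∞) :=
    (add_le_add_left h1 _).trans (h.2.trans h2)
  have h6 : (orderedEdges G Finset.univ \ orderedEdges G (majority X)).card + l ≤
      (orderedEdges G Finset.univ \ orderedEdges G ∅).card := by exact_mod_cast h5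
  omega

/-! ### Changing the cardinality of a set of vertices -/

/-- Averaging over all deletions of a vertex. -/
theorem exists_erase_card_orderedEdges (G : SimpleGraph (Fin n)) {W : Finset (Fin n)}
    (hW : W.Nonempty) : ∃ v ∈ W, (W.card - 2) * (orderedEdges G W).card ≤
      W.card * (orderedEdges G (W.erase v)).card := by
  -- Double counting: a pair survives the deletion of every vertex of `W` except its two ends.
  have hsum : ∑ v ∈ W, (orderedEdges G (W.erase v)).card =
      (W.card - 2) * (orderedEdges G W).card := by
    have h1 : ∀ v ∈ W, (orderedEdges G (W.erase v)).card =
        ∑ x ∈ orderedEdges G W, if x.1 ≠ v ∧ x.2 ≠ v then 1 else 0 := by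
      intro v _
      rw [← Finset.card_filter]
      congr 1
      ext x
      simp only [mem_orderedEdges, Finset.mem_filter, Finset.mem_erase]
      tauto
    rw [Finset.sum_congr rfl h1, Finset.sum_comm, mul_comm, ← smul_eq_mul, ← Finset.sum_const]
    refine Finset.sum_congr rfl fun x hx => ?_
    rw [mem_orderedEdges] at hx
    rw [← Finset.card_filter]
    have h2 : (W.filter fun v => x.1 ≠ v ∧ x.2 ≠ v) = (W.erase x.1).erase x.2 := by
      ext v
      simp only [Finset.mem_filter, Finset.mem_erase]
      grind
    rw [h2, Finset.card_erase_of_mem (Finset.mem_erase.2 ⟨hx.1.ne', hx.2.2⟩),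
      Finset.card_erase_of_mem hx.2.1]
    omega
  by_contra! hcon
  have h3 : ∑ v ∈ W, W.card * (orderedEdges G (W.erase v)).card <
      ∑ v ∈ W, (W.card - 2) * (orderedEdges G W).card := Finset.sum_lt_sum_of_nonempty hW hcon
  rw [← Finset.mul_sum, hsum, Finset.sum_const, smul_eq_mul] at h3
  exact lt_irrefl _ h3

/-- The set `W'` is obtained from `W` by a good step towards cardinality `k`. -/
def IsGoodStep (G : SimpleGraph (Fin n)) (k : ℕ) (W W' : Finset (Fin n)) : Prop :=
  (W.card = k → W' = W) ∧
  (W.card < k → W'.card = W.card + 1 ∧ (orderedEdges G W).card ≤ (orderedEdges G W').card) ∧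
  (k < W.card → W'.card + 1 = W.card ∧
    (W.card - 2) * (orderedEdges G W).card ≤ W.card * (orderedEdges G W').card)

section

variable {τ : Type*} {f : τ → τ} {g : τ → Finset (Fin n)} {G : SimpleGraph (Fin n)} {k : ℕ}

/-- Cardinality `k` is a fixed point, so iterating more often than necessary is harmless. The
abstract states `t` with sets `g t` will be Boolean vectors with the sets they describe. -/
theorem iterate_of_card_eq (h : ∀ t, IsGoodStep G k (g t) (g (f t))) (j : ℕ) (t : τ)
    (ht : (g t).card = k) : g (f^[j] t) = g t := by
  induction j generalizing t with
  | zero => rfl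
  | succ j ih =>
    have := (h t).1 ht
    rw [Function.iterate_succ_apply, ih _ (by rw [this, ht]), this]

theorem iterate_of_card_le (h : ∀ t, IsGoodStep G k (g t) (g (f t))) (j : ℕ) (t : τ)
    (ht : (g t).card ≤ k) (hj : k ≤ (g t).card + j) : (g (f^[j] t)).card = k ∧
      (orderedEdges G (g t)).card ≤ (orderedEdges G (g (f^[j] t))).card := by
  induction j generalizing t with
  | zero => exact ⟨le_antisymm ht hj, le_rfl⟩
  | succ j ih =>
    rcases ht.eq_or_lt with ht' | ht'
    · rw [iterate_of_card_eq h _ _ ht']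
      exact ⟨ht', le_rfl⟩
    · obtain ⟨h1, h2⟩ := (h t).2.1 ht'
      obtain ⟨h3, h4⟩ := ih (f t) (by omega) (by omega)
      exact ⟨h3, h2.trans h4⟩

/-- A good deletion from `w` vertices keeps at least the fraction `(w - 2) / w` of the pairs, which
equals `(w - 1) * (w - 2) / (w * (w - 1))`. The product telescopes, so the density does not
decrease. -/
theorem iterate_of_le_card (h : ∀ t, IsGoodStep G k (g t) (g (f t))) (j : ℕ) (t : τ)
    (ht : k ≤ (g t).card) (hj : (g t).card ≤ k + j) : (g (f^[j] t)).card = k ∧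
      (orderedEdges G (g t)).card * (k * (k - 1)) ≤
        (orderedEdges G (g (f^[j] t))).card * ((g t).card * ((g t).card - 1)) := by
  induction j generalizing t with
  | zero =>
    have : (g t).card = k := le_antisymm hj ht
    simp [this]
  | succ j ih =>
    rcases ht.eq_or_lt with ht' | ht'
    · rw [iterate_of_card_eq h _ _ ht'.symm, ← ht']
      exact ⟨rfl, le_rfl⟩
    · obtain ⟨h1, h2⟩ := (h t).2.2 ht'
      obtain ⟨h3, h4⟩ := ih (f t) (by omega) (by omega)
      refine ⟨h3, ?_⟩
      -- For `k < 2` the left-hand side vanishes. Otherwise the current set has at least 3 elements,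
      -- so the factor `w + 1` below is positive and can be cancelled.
      rcases Nat.lt_or_ge k 2 with hk | hk
      · have : k * (k - 1) = 0 := by interval_cases k <;> rfl
        simp [this]
      rw [Function.iterate_succ_apply]
      obtain ⟨w, hw⟩ : ∃ w, (g t).card = w + 3 := ⟨(g t).card - 3, by omega⟩
      have hw' : (g (f t)).card = w + 2 := by omega
      rw [hw] at h2 ⊢
      rw [hw'] at h4
      simp only [show w + 3 - 2 = w + 1 by omega, show w + 3 - 1 = w + 2 by omega,
        show w + 2 - 1 = w + 1 by omega] at h2 h4 ⊢
      refine Nat.le_of_mul_le_mul_left (c := w + 1) ?_ (by omega)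
      calc (w + 1) * ((orderedEdges G (g t)).card * (k * (k - 1)))
          = ((w + 1) * (orderedEdges G (g t)).card) * (k * (k - 1)) := by ring
        _ ≤ ((w + 3) * (orderedEdges G (g (f t))).card) * (k * (k - 1)) :=
          Nat.mul_le_mul_right _ h2
        _ = (w + 3) * ((orderedEdges G (g (f t))).card * (k * (k - 1))) := by ring
        _ ≤ (w + 3) * ((orderedEdges G (g (f^[j] (f t)))).card * ((w + 2) * (w + 1))) :=
          Nat.mul_le_mul_left _ h4
        _ = (w + 1) * ((orderedEdges G (g (f^[j] (f t)))).card * ((w + 3) * (w + 2))) := by ring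

theorem iterate_card_eq (h : ∀ t, IsGoodStep G k (g t) (g (f t))) (hk : k ≤ n) (t : τ) :
    (g (f^[n] t)).card = k := by
  have hn : (g t).card ≤ n := by simpa using Finset.card_le_univ (g t)
  rcases le_total (g t).card k with ht | ht
  · exact (iterate_of_card_le h n t ht (by omega)).1
  · exact (iterate_of_le_card h n t ht (by omega)).1

end

end

/-! ### Correctness of the operations on lists -/

section

/-- The 0/1 matrix of a relation. -/
noncomputable def matrixOf {a b : ℕ} (R : Fin a → Fin b → Prop) : List (List Bool) :=
  open Classical in List.ofFn fun i => List.ofFn fun j => decide (R i j)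

/-- The characteristic vector of a set. -/
noncomputable def vectorOf {n : ℕ} (S : Finset (Fin n)) : List Bool :=
  open Classical in List.ofFn fun i => decide (i ∈ S)

/-- The set with a given characteristic vector. -/
def toSet (n : ℕ) (W : List Bool) : Finset (Fin n) :=
  Finset.univ.filter fun i => W.getD i false = true

variable {n : ℕ}

theorem code_matrixOf {a b : ℕ} (R : Fin a → Fin b → Prop) : code (matrixOf R) = Data.ofRel R := by
  simp only [code, matrixOf, Data.ofRel, List.map_ofFn, Function.comp_def]

theorem code_vectorOf (S : Finset (Fin n)) : code (vectorOf S) = Data.ofFinset S := by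
  simp only [code, vectorOf, Data.ofFinset, List.map_ofFn, Function.comp_def]

theorem mem_toSet {W : List Bool} {i : Fin n} : i ∈ toSet n W ↔ W.getD i false = true := by
  simp [toSet]

theorem getD_vectorOf (S : Finset (Fin n)) (i : Fin n) :
    (vectorOf S).getD i false = true ↔ i ∈ S := by
  simp [vectorOf, List.getD_eq_getElem?_getD]

theorem vectorOf_toSet {W : List Bool} (h : W.length = n) : vectorOf (toSet n W) = W := by
  refine List.ext_getElem (by simp [vectorOf, h]) fun i h1 h2 => ?_
  simp [vectorOf, toSet, List.getD_eq_getElem?_getD, h2]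

theorem length_matrixOf {a b : ℕ} (R : Fin a → Fin b → Prop) : (matrixOf R).length = a := by
  simp [matrixOf]

theorem entry_matrixOf {a b : ℕ} (R : Fin a → Fin b → Prop) (i : Fin a) (j : Fin b) :
    entry (matrixOf R) i j = true ↔ R i j := by
  simp [entry, matrixOf, List.getD_eq_getElem?_getD]

theorem countP_range (n : ℕ) (p : ℕ → Bool) :
    (List.range n).countP p = (Finset.univ.filter fun i : Fin n => p i = true).card := by
  rw [Fin.univ_def, ← List.map_coe_finRange_eq_range, List.countP_map, List.countP_eq_length_filter]
  simp [Finset.filter, Function.comp_def]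

theorem countP_pairs (n : ℕ) (p : ℕ × ℕ → Bool) : (pairs n).countP p =
    (Finset.univ.filter fun x : Fin n × Fin n => p (x.1, x.2) = true).card := by
  have h : ∀ g : ℕ → ℕ, ((List.range n).map g).sum = ∑ i : Fin n, g i := fun g => by
    rw [← List.map_coe_finRange_eq_range, List.map_map, ← List.ofFn_eq_map, List.sum_ofFn]
    rfl
  rw [pairs, List.countP_flatMap, h, Finset.card_filter, Fintype.sum_prod_type]
  refine Finset.sum_congr rfl fun u _ => ?_
  rw [Function.comp_apply, List.countP_map, countP_range, Finset.card_filter]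
  rfl

theorem listCard_eq (W : List Bool) : listCard n W = (toSet n W).card := countP_range n _

theorem listEdges_eq (G : SimpleGraph (Fin n)) (W : List Bool) :
    listEdges (matrixOf G.Adj) W = (orderedEdges G (toSet n W)).card := by
  rw [listEdges, length_matrixOf, countP_pairs]
  congr 1
  ext x
  rw [Finset.mem_filter, mem_orderedEdges, mem_toSet, mem_toSet, Bool.and_eq_true,
    Bool.and_eq_true, entry_matrixOf]
  simp

theorem flatMap_range (n : ℕ) {γ : Type*} (f : ℕ → List γ) :
    (List.range n).flatMap f = (List.ofFn fun i : Fin n => f i).flatten := by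
  rw [← List.map_coe_finRange_eq_range, List.flatMap, List.map_map, List.ofFn_eq_map]
  rfl

theorem map_range (n : ℕ) {γ : Type*} (f : ℕ → γ) :
    (List.range n).map f = List.ofFn fun i : Fin n => f i := by
  rw [← List.map_coe_finRange_eq_range, List.map_map, List.ofFn_eq_map]
  rfl

/-- `finProdFinEquiv` numbers pairs in row-major order, which is the order produced by nested list
loops. This is used both for the copies and for the ordered pairs. -/
theorem ofFn_finProd {m n : ℕ} {γ : Type*} (f : Fin m × Fin n → γ) :
    List.ofFn (fun i : Fin (m * n) => f (finProdFinEquiv.symm i)) =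
      (List.ofFn fun i : Fin m => List.ofFn fun j : Fin n => f (i, j)).flatten := by
  rw [List.ofFn_mul]
  congr 2
  funext i
  congr 1
  funext j
  congr 1
  rw [Equiv.symm_apply_eq]
  apply Fin.ext
  simp [mul_comm, add_comm]

/-- The computed matrix is literally the model analysed above, so guarantees for the matroid apply
to the queries of the algorithm. -/
theorem listModel_eq (G : SimpleGraph (Fin n)) :
    listModel (matrixOf G.Adj) = matrixOf (copyModel G) := by
  classical
  conv_rhs => rw [matrixOf]
  rw [listModel, length_matrixOf, flatMap_range]
  refine Eq.trans ?_ (ofFn_finProd (fun y : Fin n × Fin (4 * n) => List.ofFn fun c : Fin (n * n) =>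
    decide (G.Adj (finProdFinEquiv.symm c).1 (finProdFinEquiv.symm c).2 ∧
      (y.1 = (finProdFinEquiv.symm c).1 ∨ y.1 = (finProdFinEquiv.symm c).2)))).symm |>.trans ?_
  · congr 2
    funext w
    rw [map_range]
    congr 1
    funext _
    rw [ofFn_finProd (fun x : Fin n × Fin n => decide (G.Adj x.1 x.2 ∧ (w = x.1 ∨ w = x.2))), pairs,
      List.map_flatMap, flatMap_range]
    congr 2
    funext u
    rw [List.map_map, map_range]
    congr 1
    funext v
    rw [Function.comp_apply, Bool.eq_iff_iff, Bool.and_eq_true, entry_matrixOf]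
    simp [Fin.ext_iff]
  · congr 1
    funext i
    congr 1
    funext c
    exact decide_eq_decide.2 Iff.rfl

theorem toSet_listMajority (X : Finset (Fin (n * (4 * n)))) :
    toSet n (listMajority n (vectorOf X)) = majority X := by
  ext w
  have h := card_filter_baseVertex (fun i => i ∈ X) w
  rw [Finset.filter_univ_mem] at h
  rw [mem_toSet, majority, Finset.mem_filter, h, listMajority, map_range]
  simp only [List.getD_eq_getElem?_getD, List.getElem?_ofFn, w.2, dif_pos, Option.getD_some,
    decide_eq_true_iff, Finset.mem_univ, true_and]
  rw [countP_range]
  have : ∀ j : Fin (4 * n), ((vectorOf X)[(w : ℕ) * (4 * n) + j]?.getD false = true ↔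
      finProdFinEquiv (w, j) ∈ X) := fun j => by
    rw [← getD_vectorOf X, List.getD_eq_getElem?_getD, finProdFinEquiv_apply_val]
    simp [mul_comm, add_comm]
  simp only [this]

theorem length_toggle (W : List Bool) (v : ℕ) : (toggle n W v).length = n := by simp [toggle]

theorem toSet_toggle_of_mem {W : List Bool} {v : Fin n} (h : v ∈ toSet n W) :
    toSet n (toggle n W v) = (toSet n W).erase v := by
  ext u
  rw [mem_toSet, List.getD_eq_getElem?_getD] at h
  rw [Finset.mem_erase, mem_toSet, mem_toSet, toggle, map_range, List.getD_eq_getElem?_getD,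
    List.getElem?_ofFn, dif_pos u.2, Option.getD_some]
  by_cases huv : u = v
  · subst huv; simp [h]
  · simp [huv, beq_false_of_ne (Fin.val_ne_of_ne huv)]

theorem toSet_toggle_of_notMem {W : List Bool} {v : Fin n} (h : v ∉ toSet n W) :
    toSet n (toggle n W v) = insert v (toSet n W) := by
  ext u
  rw [mem_toSet, List.getD_eq_getElem?_getD] at h
  rw [Finset.mem_insert, mem_toSet, mem_toSet, toggle, map_range, List.getD_eq_getElem?_getD,
    List.getElem?_ofFn, dif_pos u.2, Option.getD_some]
  by_cases huv : u = v
  · subst huv; simp [h]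
  · simp [huv, beq_false_of_ne (Fin.val_ne_of_ne huv)]

theorem le_foldl_bif {ι : Type} (s : ι → ℕ) (l : List ι) (i : ι) :
    s i ≤ s (l.foldl (fun x c => bif decide (s x < s c) then c else x) i) ∧
      ∀ x ∈ l, s x ≤ s (l.foldl (fun x c => bif decide (s x < s c) then c else x) i) := by
  induction l generalizing i with
  | nil => simp
  | cons c l ih =>
    obtain ⟨h1, h2⟩ := ih (bif decide (s i < s c) then c else i)
    rw [List.foldl_cons]
    have h3 : s i ≤ s (bif decide (s i < s c) then c else i) ∧
        s c ≤ s (bif decide (s i < s c) then c else i) := by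
      by_cases h : s i < s c
      · simp [h, h.le]
      · simp [h, not_lt.1 h]
    exact ⟨h3.1.trans h1, fun x hx => (List.mem_cons.1 hx).elim (fun e => e ▸ h3.2.trans h1) (h2 x)⟩

theorem listEdges_le_bestOf (M : List (List Bool)) {l : List (List Bool)} {W : List Bool}
    (h : W ∈ l) : listEdges M W ≤ listEdges M (bestOf M l) :=
  (le_foldl_bif (listEdges M) l (l.headD [])).2 W h

theorem adjust_of_card_eq (G : SimpleGraph (Fin n)) {k : ℕ} {W : List Bool}
    (h : (toSet n W).card = k) : adjust (matrixOf G.Adj) k W = W := by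
  simp [adjust, length_matrixOf, listCard_eq, h]

/-- An adjustment is a best insertion or a best deletion. -/
theorem adjust_of_card_ne (G : SimpleGraph (Fin n)) {k : ℕ} (hk : k ≤ n) {W : List Bool}
    (h : (toSet n W).card ≠ k) :
    (∃ v : Fin n, (v ∈ toSet n W ↔ k < (toSet n W).card) ∧
      adjust (matrixOf G.Adj) k W = toggle n W v) ∧
    ∀ v : Fin n, (v ∈ toSet n W ↔ k < (toSet n W).card) →
      (orderedEdges G (toSet n (toggle n W v))).card ≤
        (orderedEdges G (toSet n (adjust (matrixOf G.Adj) k W))).card := by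
  have hadj : adjust (matrixOf G.Adj) k W =
      bestOf (matrixOf G.Adj) ((toggleable n k W).map (toggle n W)) := by
    simp [adjust, length_matrixOf, listCard_eq, beq_false_of_ne h]
  have hmem : ∀ v : Fin n, (v : ℕ) ∈ toggleable n k W ↔
      (v ∈ toSet n W ↔ k < (toSet n W).card) := by
    intro v
    rw [toggleable, List.mem_filter, List.mem_range, listCard_eq, mem_toSet, beq_iff_eq,
      Bool.eq_iff_iff, decide_eq_true_iff]
    simp [v.2]
  -- Some vertex is eligible: if the set is too small, `k ≤ n` leaves a vertex outside it; if it is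
  -- too large, it is nonempty.
  have hne : ∃ v : Fin n, (v ∈ toSet n W ↔ k < (toSet n W).card) := by
    rcases lt_or_gt_of_ne h with h' | h'
    · have : ∃ v : Fin n, v ∉ toSet n W := by
        by_contra! hall
        rw [Finset.eq_univ_iff_forall.2 hall, Finset.card_univ, Fintype.card_fin] at h'
        omega
      obtain ⟨v, hv⟩ := this
      exact ⟨v, by simp [hv, h'.le]⟩
    · obtain ⟨v, hv⟩ := Finset.card_pos.1 (show 0 < (toSet n W).card by omega)
      exact ⟨v, by simp [hv, h']⟩
  refine ⟨?_, fun v hv => ?_⟩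
  · obtain ⟨v, hv⟩ := hne
    have hl : (toggleable n k W).map (toggle n W) ≠ [] :=
      List.ne_nil_of_mem (List.mem_map_of_mem ((hmem v).2 hv))
    obtain ⟨u, hu, hu'⟩ := List.mem_map.1 (bestOf_mem (matrixOf G.Adj) hl)
    have hun : u < n := by
      rw [toggleable, List.mem_filter, List.mem_range] at hu
      exact hu.1
    exact ⟨⟨u, hun⟩, (hmem ⟨u, hun⟩).1 hu, by rw [hadj, ← hu']⟩
  · rw [hadj, ← listEdges_eq, ← listEdges_eq]
    exact listEdges_le_bestOf _ (List.mem_map_of_mem ((hmem v).2 hv))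

/-- Insertion destroys no edge, and the best deletion is at least as good as the one found by
averaging. -/
theorem isGoodStep_adjust (G : SimpleGraph (Fin n)) {k : ℕ} (hk : k ≤ n) (W : List Bool) :
    IsGoodStep G k (toSet n W) (toSet n (adjust (matrixOf G.Adj) k W)) := by
  refine ⟨fun h => by rw [adjust_of_card_eq G h], fun h => ?_, fun h => ?_⟩
  · obtain ⟨⟨v, hv, hadj⟩, -⟩ := adjust_of_card_ne G hk h.ne
    have hv' : v ∉ toSet n W := fun hm => by have := hv.1 hm; omega
    rw [hadj, toSet_toggle_of_notMem hv']
    exact ⟨Finset.card_insert_of_notMem hv',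
      Finset.card_le_card (orderedEdges_mono G (Finset.subset_insert _ _))⟩
  · obtain ⟨⟨v, hv, hadj⟩, hmax⟩ := adjust_of_card_ne G hk h.ne'
    have hv' := hv.2 h
    obtain ⟨u, hu, hle⟩ := exists_erase_card_orderedEdges G ⟨v, hv'⟩
    refine ⟨?_, hle.trans (Nat.mul_le_mul_left _ ?_)⟩
    · rw [hadj, toSet_toggle_of_mem hv', Finset.card_erase_add_one hv']
    · rw [← toSet_toggle_of_mem hu]
      exact hmax u (by simp [hu, h])

theorem length_adjust (G : SimpleGraph (Fin n)) {k : ℕ} (hk : k ≤ n) {W : List Bool}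
    (h : W.length = n) : (adjust (matrixOf G.Adj) k W).length = n := by
  by_cases hc : (toSet n W).card = k
  · rw [adjust_of_card_eq G hc, h]
  · obtain ⟨⟨v, -, hv⟩, -⟩ := adjust_of_card_ne G hk hc
    rw [hv, length_toggle]

theorem length_resize (G : SimpleGraph (Fin n)) {k : ℕ} (hk : k ≤ n) {W : List Bool}
    (h : W.length = n) : (resize (matrixOf G.Adj) k W).length = n := by
  have : ∀ i, ((adjust (matrixOf G.Adj) k)^[i] W).length = n := by
    intro i
    induction i with
    | zero => exact h
    | succ i ih => rw [Function.iterate_succ_apply']; exact length_adjust G hk ih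
  exact this _

theorem card_toSet_resize (G : SimpleGraph (Fin n)) {k : ℕ} (hk : k ≤ n) (W : List Bool) :
    (toSet n (resize (matrixOf G.Adj) k W)).card = k := by
  rw [resize, length_matrixOf]
  exact iterate_card_eq (isGoodStep_adjust G hk) hk W

/-- The extra candidate `[]` guarantees a valid output even when `L` is empty, which happens for
graphs without edges. -/
theorem bestResized_eq (G : SimpleGraph (Fin n)) {k : ℕ} (hk : k ≤ n) (L : List (List Bool)) :
    (bestResized (matrixOf G.Adj) k L).length = n ∧
      (toSet n (bestResized (matrixOf G.Adj) k L)).card = k := by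
  obtain ⟨X, -, hX⟩ := List.mem_map.1 (bestOf_mem (matrixOf G.Adj)
    (l := ([] :: L).map fun X => resize (matrixOf G.Adj) k
      (listMajority (matrixOf G.Adj).length X)) (by simp))
  rw [bestResized, ← hX]
  exact ⟨length_resize G hk (by simp [listMajority, length_matrixOf]), card_toSet_resize G hk _⟩

/-- The guarantee of the algorithm in terms of the majority set of any of the given sets of rows. -/
theorem card_orderedEdges_bestResized (G : SimpleGraph (Fin n)) {k : ℕ} (hk : k ≤ n)
    {L : List (List Bool)} {X : Finset (Fin (n * (4 * n)))} (hX : vectorOf X ∈ L) :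
    (orderedEdges G (majority X)).card ≤
        (orderedEdges G (toSet n (bestResized (matrixOf G.Adj) k L))).card ∨
      k ≤ (majority X).card ∧ (orderedEdges G (majority X)).card * (k * (k - 1)) ≤
        (orderedEdges G (toSet n (bestResized (matrixOf G.Adj) k L))).card *
          ((majority X).card * ((majority X).card - 1)) := by
  have h1 := listEdges_le_bestOf (matrixOf G.Adj) (List.mem_map_of_mem
    (f := fun X => resize (matrixOf G.Adj) k (listMajority (matrixOf G.Adj).length X))
    (List.mem_cons_of_mem [] hX))
  rw [listEdges_eq, listEdges_eq, resize, length_matrixOf] at h1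
  have hn : (majority X).card ≤ n := by simpa using Finset.card_le_univ (majority X)
  have hset := toSet_listMajority X
  simp only [bestResized, length_matrixOf] at h1 ⊢
  rcases le_total (majority X).card k with hle | hle
  · have h2 := iterate_of_card_le (isGoodStep_adjust G hk) n (listMajority n (vectorOf X))
      (by rwa [hset]) (by omega)
    rw [hset] at h2
    exact Or.inl (h2.2.trans h1)
  · have h2 := iterate_of_le_card (isGoodStep_adjust G hk) n (listMajority n (vectorOf X))
      (by rwa [hset]) (by rw [hset]; omega)
    rw [hset] at h2
    exact Or.inr ⟨hle, h2.2.trans (Nat.mul_le_mul_right _ h1)⟩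

end

/-! ### The algorithm -/

/-- The instances of the rank reduction problem that have a feasible solution. -/
structure RankInstance where
  /-- The number of elements. -/
  m : ℕ
  /-- The number of vertices on the other side of the model. -/
  b : ℕ
  /-- The amount by which the rank is to be reduced. -/
  k : ℕ
  /-- The model of the matroid. -/
  H : Fin m → Fin b → Prop
  one_le : 1 ≤ k
  le_eRank : (k : ℕ∞) ≤ (transversalMatroid H).eRank

/-- The instances of the densest subgraph problem. -/
structure SubgraphInstance where
  /-- The number of vertices. -/
  n : ℕ
  /-- The number of vertices of the subgraph. -/
  k : ℕ
  /-- The graph. -/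
  G : SimpleGraph (Fin n)
  one_le : 1 ≤ k
  le : k ≤ n

noncomputable instance : Coded RankInstance := ⟨fun I => .cons (Data.ofRel I.H) (Data.ofNat I.k)⟩

noncomputable instance : Coded SubgraphInstance :=
  ⟨fun I => .cons (Data.ofRel I.G.Adj) (Data.ofNat I.k)⟩

theorem code_rankInstance (I : RankInstance) : code I = code (matrixOf I.H, I.k) := by
  rw [code_pair, code_matrixOf]; rfl

theorem code_subgraphInstance (I : SubgraphInstance) : code I = code (matrixOf I.G.Adj, I.k) := by
  rw [code_pair, code_matrixOf]; rfl

namespace SubgraphInstance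

/-- The rank reduction instance in which the rank is to be reduced by `l + 1`. -/
def query (I : SubgraphInstance) (l : Fin (orderedEdges I.G Finset.univ).card) : RankInstance where
  m := I.n * (4 * I.n)
  b := I.n * I.n
  k := (l : ℕ) + 1
  H := copyModel I.G
  one_le := Nat.le_add_left 1 _
  le_eRank := le_trans (by exact_mod_cast l.2) (card_orderedEdges_le_eRank I.G)

/-- The rank reduction instances to be solved, as a list of instances. -/
noncomputable def instances (I : SubgraphInstance) : List RankInstance :=
  (List.finRange (orderedEdges I.G Finset.univ).card).map I.query

/-- The instances carry feasibility proofs that no program handles; on the level of codes they are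
just the computable list `queries`. -/
theorem code_instances (I : SubgraphInstance) :
    code I.instances = code (queries (matrixOf I.G.Adj)) := by
  have h : toSet I.n ((List.range I.n).map fun _ => true) = Finset.univ := by
    ext v
    simp [mem_toSet, List.getD_eq_getElem?_getD]
  simp only [queries, listEdges_eq, length_matrixOf, h, listModel_eq]
  rw [← List.map_coe_finRange_eq_range]
  change Data.ofList _ = Data.ofList _
  rw [instances, List.map_map, List.map_map, List.map_map]
  exact congrArg Data.ofList (List.map_congr_left fun l _ => code_rankInstance (I.query l))

/-- The output of the algorithm, given an algorithm for the rank reduction problem. -/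
noncomputable def solution (X : ∀ I : RankInstance, Finset (Fin I.m)) (I : SubgraphInstance) :
    List Bool :=
  bestResized (matrixOf I.G.Adj) I.k (I.instances.map fun J => vectorOf (X J))

theorem polyTime_solution {X : ∀ I : RankInstance, Finset (Fin I.m)}
    (hX : PolyTime fun J => vectorOf (X J)) : PolyTime (solution X) := by
  have h : PolyTime fun I : SubgraphInstance => (matrixOf I.G.Adj, I.k) :=
    polyTime_of_code_eq fun I => (code_subgraphInstance I).symm
  have hM : PolyTime fun I : SubgraphInstance => matrixOf I.G.Adj := h.fst
  have hk : PolyTime fun I : SubgraphInstance => I.k := h.snd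
  have hI : PolyTime instances := (PolyTime.queries hM).congr_code code_instances
  exact hM.bestResized hk (hI.list_map (hX.comp PolyTime.id.snd))

end SubgraphInstance

/-- Since `RankInstance` contains only feasible instances, the given algorithm is correct on the
whole type and fits `PolyTime`. Its output has `I.m` bits, and `I.m` is at most the size of the
input matrix. -/
theorem polyTime_vectorOf {X : ∀ I : RankInstance, Finset (Fin I.m)} (P : Cmd) (p : Polynomial ℕ)
    (h : ∀ I, ComputesWithin P (code I) (p.eval (codeSize I)) (Data.ofFinset (X I))) :
    PolyTime fun I => vectorOf (X I) := by
  refine polyTime_of_computesWithin P p (4 * Polynomial.X + 1) (fun I => ?_) fun I => ?_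
  · rw [code_vectorOf]; exact h I
  · have h1 := codeSize_le_of_forall (l := vectorOf (X I)) (N := 3) fun b _ => codeSize_bool_le b
    have h2 : I.m ≤ codeSize I := by
      rw [codeSize, code_rankInstance]
      have := length_le_codeSize (matrixOf I.H)
      rw [length_matrixOf] at this
      have := codeSize_pair (matrixOf I.H) I.k
      rw [codeSize] at this
      omega
    rw [vectorOf, List.length_ofFn] at h1
    simp only [Polynomial.eval_add, Polynomial.eval_mul, Polynomial.eval_ofNat, Polynomial.eval_X,
      Polynomial.eval_one]
    rw [vectorOf]
    omega

/-! ### The approximation guarantee -/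

/-- The arithmetic of the approximation guarantee: `e` is the optimum, `d` the value of the output,
`w` the size of a set that contains at least `2 e` ordered pairs of adjacent vertices. -/
theorem le_of_resized {e d k w E : ℕ} {ρ : ℝ} (hk : 2 ≤ k) (hw : (w : ℝ) ≤ 2 * ρ * k)
    (hE : 2 * e ≤ E) (h : E * (k * (k - 1)) ≤ 2 * d * (w * (w - 1))) :
    (e : ℝ) ≤ 8 * ρ ^ 2 * d := by
  have h1 : 2 * e * (k * (k - 1)) ≤ 2 * d * (w * w) :=
    (Nat.mul_le_mul_right _ hE).trans (h.trans (by gcongr; omega))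
  -- As `k ≥ 2`, `k * k ≤ 2 * (k * (k - 1))`.
  have h2 : e * (k * k) ≤ 2 * d * (w * w) := by
    refine le_trans ?_ h1
    obtain ⟨j, rfl⟩ : ∃ j, k = j + 2 := ⟨k - 2, by omega⟩
    rw [show j + 2 - 1 = j + 1 by omega, mul_comm 2 e, mul_assoc]
    exact Nat.mul_le_mul_left _ (by nlinarith)
  have h3 : (e : ℝ) * (k * k) ≤ 2 * d * (w * w) := by exact_mod_cast h2
  have h4 : (w : ℝ) * w ≤ (2 * ρ * k) * (2 * ρ * k) :=
    mul_self_le_mul_self (Nat.cast_nonneg w) hw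
  have h5 : (0 : ℝ) < k * k := by positivity
  refine le_of_mul_le_mul_right ?_ h5
  calc (e : ℝ) * (k * k) ≤ 2 * d * (w * w) := h3
    _ ≤ 2 * d * ((2 * ρ * k) * (2 * ρ * k)) := by gcongr
    _ = 8 * ρ ^ 2 * d * (k * k) := by ring

/-- Among the queries is the one asking for a reduction by the number of ordered pairs in `S`. For
it the copies of `S` compete with the returned set, whose majority is therefore small yet rich in
edges. The 1 in the maximum covers majorities that have to be enlarged. -/
theorem inducedEdges_le_of_approx {c ε : ℝ} {X : ∀ I : RankInstance, Finset (Fin I.m)}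
    (hred : ∀ I, ReducesRank (transversalMatroid I.H) I.k (X I : Set (Fin I.m)))
    (hopt : ∀ I, ∀ X' : Finset (Fin I.m),
      ReducesRank (transversalMatroid I.H) I.k (X' : Set (Fin I.m)) →
      ((X I).card : ℝ) ≤ c * (I.m : ℝ) ^ ε * (X'.card : ℝ))
    (I : SubgraphInstance) {S : Finset (Fin I.n)} (hS : S.card = I.k) :
    (inducedEdges I.G S : ℝ) ≤ max 1 (8 * (c * ((I.n * (4 * I.n) : ℕ) : ℝ) ^ ε) ^ 2) *
      inducedEdges I.G (toSet I.n (I.solution X)) := by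
  set d := inducedEdges I.G (toSet I.n (I.solution X)) with hd
  set ρ := c * ((I.n * (4 * I.n) : ℕ) : ℝ) ^ ε with hρ
  rcases Nat.eq_zero_or_pos (inducedEdges I.G S) with he | he
  · rw [he, Nat.cast_zero]
    positivity
  set e := inducedEdges I.G S with he'
  have heS : (orderedEdges I.G S).card = 2 * e := card_orderedEdges I.G S
  have hle : 2 * e ≤ (orderedEdges I.G Finset.univ).card := by
    rw [← heS]
    exact Finset.card_le_card (orderedEdges_mono I.G (Finset.subset_univ S))
  have hk : 2 ≤ I.k := by
    obtain ⟨x, hx⟩ := Finset.card_pos.1 (show 0 < (orderedEdges I.G S).card by omega)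
    rw [mem_orderedEdges] at hx
    rw [← hS]
    exact Finset.one_lt_card.2 ⟨x.1, hx.2.1, x.2, hx.2.2, hx.1.ne⟩
  -- `X J` lives in `Fin J.m`; naming it `Y` over the fixed type of copies avoids transport along
  -- the equality of instances.
  have hJ : ∃ J ∈ I.instances, ∃ Y : Finset (Fin (I.n * (4 * I.n))), vectorOf (X J) = vectorOf Y ∧
      ReducesRank (transversalMatroid (copyModel I.G)) (2 * e)
        (Y : Set (Fin (I.n * (4 * I.n)))) ∧
      (Y.card : ℝ) ≤ ρ * (copiesOf S).card := by
    -- The index is `2 * e - 1` because query `l` asks for a reduction by `l + 1`.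
    let l : Fin (orderedEdges I.G Finset.univ).card := ⟨2 * e - 1, by omega⟩
    have hk' : (I.query l).k = 2 * e := Nat.sub_add_cancel (show 1 ≤ 2 * e by omega)
    refine ⟨I.query l, List.mem_map_of_mem (List.mem_finRange l), X (I.query l), rfl, ?_, ?_⟩
    · have := hred (I.query l)
      rwa [hk'] at this
    · refine hopt (I.query l) (copiesOf S) ?_
      rw [hk']
      exact reducesRank_copiesOf I.G S heS.ge
  obtain ⟨J, hJ, Y, hXY, hYred, hYcard⟩ := hJ
  have hE := le_card_orderedEdges_majority I.G hYred
  have hmem : vectorOf Y ∈ I.instances.map fun J => vectorOf (X J) :=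
    List.mem_map.2 ⟨J, hJ, hXY⟩
  have hmain := card_orderedEdges_bestResized I.G I.le hmem
  change _ ≤ (orderedEdges I.G (toSet I.n (I.solution X))).card ∨ _ ∧
    _ ≤ (orderedEdges I.G (toSet I.n (I.solution X))).card * _ at hmain
  rw [card_orderedEdges I.G (toSet I.n (I.solution X)), ← hd] at hmain
  rcases hmain with h | ⟨-, h⟩
  · have h1 : e ≤ d := by omega
    calc (e : ℝ) ≤ 1 * d := by rw [one_mul]; exact_mod_cast h1
      _ ≤ _ := by gcongr; exact le_max_left _ _
  -- Divide `2 * n * |W| ≤ |Y| ≤ ρ * (4 * n * k)` by `2 * n`.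
  · have hw : ((majority Y).card : ℝ) ≤ 2 * ρ * I.k := by
      have hn : (0 : ℝ) < 2 * I.n := by
        have := I.one_le.trans I.le
        positivity
      have h1 : (2 * I.n * (majority Y).card : ℝ) ≤ Y.card := by
        exact_mod_cast card_majority_le Y
      rw [card_copiesOf, hS] at hYcard
      push_cast at hYcard
      refine le_of_mul_le_mul_left ?_ hn
      linarith
    refine (le_of_resized hk hw hE h).trans ?_
    gcongr
    exact le_max_right _ _

end RankReduction

theorem mainTheorem3 (ε : ℝ) (hε₀ : 0 < ε) (hε₁ : ε < 1 / 4) (P : RankReduction.Cmd)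
    (hP : ∃ c : ℝ, RankReduction.IsRankReductionApprox P (fun m => c * (m : ℝ) ^ ε)) :
    ∃ Q : RankReduction.Cmd, ∃ C : ℝ,
      RankReduction.IsDensestSubgraphApprox Q (fun n => C * (n : ℝ) ^ (4 * ε)) := by
  open RankReduction in
  obtain ⟨c, p, hp⟩ := hP
  choose X hX hred hopt using fun I : RankInstance => hp I.m I.b I.k I.H I.one_le I.le_eRank
  obtain ⟨Q, q, hQ⟩ := (SubgraphInstance.polyTime_solution
    (polyTime_vectorOf P p hX)).exists_computesWithin
  -- `8 * (c * (4 * n ^ 2) ^ ε) ^ 2 = 8 * c ^ 2 * 4 ^ (2 * ε) * n ^ (4 * ε)`; the added 1 absorbs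
  -- the maximum with 1, because `n ^ (4 * ε) ≥ 1`.
  refine ⟨Q, 8 * c ^ 2 * 4 ^ (2 * ε) + 1, q, fun n k G hk hkn => ?_⟩
  let I : SubgraphInstance := ⟨n, k, G, hk, hkn⟩
  obtain ⟨hlen, hcard⟩ := bestResized_eq G hkn (I.instances.map fun J => vectorOf (X J))
  refine ⟨toSet n (I.solution X), ?_, hcard, fun S hS => ?_⟩
  · rw [← code_vectorOf, SubgraphInstance.solution, vectorOf_toSet hlen]
    exact hQ I
  · refine (inducedEdges_le_of_approx hred hopt I hS).trans ?_
    refine mul_le_mul_of_nonneg_right ?_ (Nat.cast_nonneg _)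
    have hn : (1 : ℝ) ≤ n := by exact_mod_cast hk.trans hkn
    have hpow : (1 : ℝ) ≤ (n : ℝ) ^ (4 * ε) := Real.one_le_rpow hn (by linarith)
    have hsq : 8 * (c * ((n * (4 * n) : ℕ) : ℝ) ^ ε) ^ 2 =
        8 * c ^ 2 * 4 ^ (2 * ε) * (n : ℝ) ^ (4 * ε) := by
      have h1 : (((n * (4 * n) : ℕ) : ℝ) ^ ε) ^ 2 = 4 ^ (2 * ε) * (n : ℝ) ^ (4 * ε) := by
        have h0 : (0 : ℝ) ≤ n := by linarith
        rw [show ((n * (4 * n) : ℕ) : ℝ) = 4 * (n : ℝ) ^ (2 : ℝ) by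
          rw [Real.rpow_two]; push_cast; ring]
        rw [Real.mul_rpow (by norm_num) (by positivity), mul_pow, ← Real.rpow_mul h0,
          ← Real.rpow_mul_natCast (by norm_num), ← Real.rpow_mul_natCast h0]
        congr 2 <;> push_cast <;> ring
      rw [mul_pow, h1]
      ring
    have hC : 0 ≤ 8 * c ^ 2 * (4 : ℝ) ^ (2 * ε) := by positivity
    refine max_le ?_ ?_
    · nlinarith
    · rw [show I.n = n from rfl, hsq]
      nlinarith
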